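/- Let $\mathbb K$ be an algebraically closed field of characteristic zero and let $N=2m$ with $m\ge 1$. Let $A_N=\mathbb K[t_1^{\pm1},\dots,t_N^{\pm1}]$, $d_i=t_i\,\partial/\partial t_i$, and for $u\in\mathbb K^N$, $r\in\mathbb Z^N$ put $D(u,r)=\sum_i u_i t^r d_i\in\mathrm{Der}_{\mathbb K}(A_N)$. Let $J=\begin{pmatrix}0&I_m\\-I_m&0\end{pmatrix}$, $\bar r=Jr$, $h_r=D(\bar r,r)$, $\mathfrak h=\mathrm{span}_{\mathbb K}\{d_1,\dots,d_N\}=\{D(u,0): u\in\mathbb K^N\}$. The Hamiltonian Lie algebra is $\mathcal H_N=\mathrm{span}_{\mathbb K}\{h_r: r\in\mathbb Z^N\}+\mathfrak h$ with the commutator bracket, and $\mathcal H_N'=[\mathcal H_N,\mathcal H_N]$. Let $$\mathrm{GSp}_N(\mathbb Z)=\{Q\in \mathrm{GL}_N(\mathbb Z): Q^{\top}JQ=\varepsilon J\text{ for some }\varepsilon\in\{1,-1\}\}.$$ For $\lambda\in(\mathbb K^\times)^N$ and $r\in\mathbb Z^N$ write $\lambda^r=\prod_i\lambda_i^{r_i}$.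 Let $\mathrm{GSp}_N(\mathbb Z)$ act on $(\mathbb K^\times)^N$ by group automorphisms via $(Q\cdot\lambda)_i=\lambda^{Q^{-1}e_i}$, equivalently $(Q\cdot\lambda)^r=\lambda^{Q^{-1}r}$, and form the corresponding semidirect product $\mathrm{GSp}_N(\mathbb Z)\ltimes(\mathbb K^\times)^N$, with multiplication $(\lambda,P)(\mu,Q)=(\lambda\,(P\cdot\mu),PQ)$. Then $\mathrm{Aut}(\mathcal H_N)\cong\mathrm{Aut}(\mathcal H_N')\cong \mathrm{GSp}_N(\mathbb Z)\ltimes(\mathbb K^\times)^N$. More precisely: 1. There are group isomorphisms $\Phi:\mathrm{Aut}(\mathcal H_N)\to \mathrm{GSp}_N(\mathbb Z)\ltimes(\mathbb K^\times)^N$ and $\Psi:\mathrm{Aut}(\mathcal H_N')\to \mathrm{GSp}_N(\mathbb Z)\ltimes(\mathbb K^\times)^N$ such that $\Psi^{-1}\circ\Phi$ is the restriction $\sigma\mapsto\sigma|_{\mathcal H_N'}$, and such that for every $\sigma\in\mathrm{Aut}(\mathcal H_N)$ with $\Phi(\sigma)=(\lambda,Q)$, $$\sigma(h_r)=\lambda^{Qr}\,D(Q^{-\top}\bar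 r,\,Qr)\quad(r\in\mathbb Z^N),\qquad \sigma(D(u,0))=D(Q^{-\top}u,0)\quad(u\in\mathbb K^N).$$ 2. Every $\sigma\in\mathrm{Aut}(\mathcal H_N)$ satisfies $\sigma(\mathcal H_N')=\mathcal H_N'$ and $\sigma(\mathfrak h)=\mathfrak h$. -/

import Mathlib

open scoped Matrix

namespace HamTorus

noncomputable section

/-! ### The Witt algebra -/

/-- The algebra `K[t_i^{±1} : i ∈ ι]` of Laurent polynomials; `single n 1` is the monomial `t^n`. -/
abbrev Laurent (K ι : Type*) [Field K] : Type _ := AddMonoidAlgebra K (ι → ℤ)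

/-- The Witt algebra: the Lie algebra of all `K`-derivations of the Laurent polynomials, with the
commutator bracket. -/
abbrev Witt (K ι : Type*) [Field K] : Type _ := Derivation K (Laurent K ι) (Laurent K ι)

/-- The `K`-linear map `t^n ↦ n_i t^n`. -/
def degreeMap (K : Type*) {ι : Type*} [Field K] (i : ι) : Laurent K ι →ₗ[K] Laurent K ι :=
  Finsupp.lsum K (fun n : ι → ℤ => (n i : K) • AddMonoidAlgebra.lsingle n) ∘ₗ
    (AddMonoidAlgebra.coeffLinearEquiv K).toLinearMap

theorem degreeMap_single {K ι : Type*} [Field K] (i : ι) (n : ι → ℤ) (c : K) :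
    degreeMap K i (AddMonoidAlgebra.single n c) = AddMonoidAlgebra.single n ((n i : K) * c) := by
  simp [degreeMap, AddMonoidAlgebra.lsingle]

/-- The degree derivation `d_i = t_i ∂/∂t_i`. -/
def degreeDer (K : Type*) {ι : Type*} [Field K] (i : ι) : Witt K ι :=
  Derivation.mk' (degreeMap K i) (by
    intro a b
    induction a using AddMonoidAlgebra.induction_linear with
    | zero => simp
    | add x y hx hy => simp only [add_mul, map_add, hx, hy, smul_eq_mul, mul_add]; ring
    | single n c =>
      induction b using AddMonoidAlgebra.induction_linear with
      | zero => simp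
      | add x y hx hy => simp only [add_mul, map_add, hx, hy, smul_eq_mul, mul_add]; ring
      | single k e =>
        simp only [AddMonoidAlgebra.single_mul_single, degreeMap_single, smul_eq_mul]
        rw [add_comm k n, ← AddMonoidAlgebra.single_add]
        congr 1
        push_cast [Pi.add_apply]
        ring)

theorem degreeDer_single {K ι : Type*} [Field K] (i : ι) (n : ι → ℤ) (c : K) :
    degreeDer K i (AddMonoidAlgebra.single n c) = AddMonoidAlgebra.single n ((n i : K) * c) :=
  degreeMap_single i n c

/-- The derivation `D(u,r) = ∑ i, u_i t^r d_i`. -/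
def D {K ι : Type*} [Field K] [Fintype ι] (u : ι → K) (r : ι → ℤ) : Witt K ι :=
  ∑ i, u i • ((AddMonoidAlgebra.single r 1 : Laurent K ι) • degreeDer K i)

/-- The image in `K^ι` of an integer vector. -/
def castVec (K : Type*) {ι : Type*} [Field K] (r : ι → ℤ) : ι → K := fun i => (r i : K)

theorem castVec_add {K ι : Type*} [Field K] (r s : ι → ℤ) :
    castVec K (r + s) = castVec K r + castVec K s := by
  ext i; simp [castVec]

theorem D_single {K ι : Type*} [Field K] [Fintype ι] (u : ι → K) (r n : ι → ℤ) (c : K) :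
    D u r (AddMonoidAlgebra.single n c) =
      AddMonoidAlgebra.single (r + n) ((u ⬝ᵥ castVec K n) * c) := by
  have h (i : ι) : (u i • ((AddMonoidAlgebra.single r 1 : Laurent K ι) • degreeDer K i))
      (AddMonoidAlgebra.single n c) = AddMonoidAlgebra.single (r + n) (u i * (n i : K) * c) := by
    simp [degreeDer_single, AddMonoidAlgebra.single_mul_single, mul_assoc]
  rw [D, ← Derivation.coeFnAddMonoidHom_apply, map_sum, Finset.sum_apply]
  simp only [Derivation.coeFnAddMonoidHom_apply, h, dotProduct, castVec, Finset.sum_mul]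
  exact (map_sum (AddMonoidAlgebra.lsingle (R := K) (S := K) (r + n)) _ _).symm

theorem witt_ext {K ι : Type*} [Field K] {X Y : Witt K ι}
    (h : ∀ n c, X (AddMonoidAlgebra.single n c) = Y (AddMonoidAlgebra.single n c)) : X = Y := by
  ext1 a
  induction a using AddMonoidAlgebra.induction_linear with
  | zero => simp
  | add x y hx hy => simp [hx, hy]
  | single n c => exact h n c

/-- The commutator relations of the Witt algebra. -/
theorem D_lie {K ι : Type*} [Field K] [Fintype ι] (u v : ι → K) (r s : ι → ℤ) :
    ⁅D u r, D v s⁆ =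
      D ((u ⬝ᵥ castVec K s) • v - (v ⬝ᵥ castVec K r) • u) (r + s) := by
  apply witt_ext
  intro n c
  rw [Derivation.commutator_apply]
  simp only [D_single, castVec_add, dotProduct_add, sub_dotProduct, smul_dotProduct, smul_eq_mul]
  rw [← add_assoc, ← add_assoc, add_comm s r, ← AddMonoidAlgebra.single_sub]
  congr 1
  ring

/-- `u ↦ D(u,r)` as a linear map. -/
def DLin (K : Type*) {ι : Type*} [Field K] [Fintype ι] (r : ι → ℤ) : (ι → K) →ₗ[K] Witt K ι where
  toFun u := D u r
  map_add' u v := by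
    apply witt_ext; intro n c; simp [D_single, add_dotProduct, add_mul]
  map_smul' a u := by
    apply witt_ext; intro n c; simp [D_single, mul_assoc]

/-! ### The Hamiltonian algebra; the coordinates are indexed by `Fin m ⊕ Fin m`, so `N = 2m` -/

/-- The standard symplectic matrix with block rows `(0, I)` and `(-I, 0)`. -/
def J (m : ℕ) : Matrix (Fin m ⊕ Fin m) (Fin m ⊕ Fin m) ℤ := Matrix.fromBlocks 0 1 (-1) 0

/-- `h_r = D(J r, r)`. -/
def h (K : Type*) [Field K] (m : ℕ) (r : Fin m ⊕ Fin m → ℤ) : Witt K (Fin m ⊕ Fin m) :=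
  D (castVec K (J m *ᵥ r)) r

/-- The span `𝔥` of the degree derivations `d_i` in the Witt algebra. -/
def cartan (K : Type*) [Field K] (m : ℕ) : Submodule K (Witt K (Fin m ⊕ Fin m)) :=
  Submodule.span K (Set.range (degreeDer K))

theorem cartan_eq (K : Type*) [Field K] (m : ℕ) : cartan K m = LinearMap.range (DLin K 0) := by
  classical
  apply le_antisymm
  · rw [cartan, Submodule.span_le]
    rintro _ ⟨i, rfl⟩
    refine ⟨Pi.single i 1, ?_⟩
    apply witt_ext; intro n c
    simp [DLin, D_single, degreeDer_single, castVec]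
  · rintro _ ⟨u, rfl⟩
    change D u 0 ∈ _
    refine Submodule.sum_mem _ fun i _ => Submodule.smul_mem _ _ ?_
    rw [← AddMonoidAlgebra.one_def, one_smul]
    exact Submodule.subset_span ⟨i, rfl⟩

theorem D_zero_mem_cartan {K : Type*} [Field K] {m : ℕ} (u : Fin m ⊕ Fin m → K) :
    D u 0 ∈ cartan K m := by
  rw [cartan_eq]; exact ⟨u, rfl⟩

theorem J_skew {K : Type*} [Field K] {m : ℕ} (r s : Fin m ⊕ Fin m → ℤ) :
    castVec K (J m *ᵥ s) ⬝ᵥ castVec K r = -(castVec K (J m *ᵥ r) ⬝ᵥ castVec K s) := by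
  simp only [J, castVec, dotProduct, Fintype.sum_sum_type, Matrix.fromBlocks_mulVec, Sum.elim_inl,
    Sum.elim_inr, Matrix.zero_mulVec, Matrix.one_mulVec, Matrix.neg_mulVec, zero_add, add_zero,
    Function.comp, Pi.neg_apply, Int.cast_neg, neg_mul, Finset.sum_neg_distrib]
  simp only [mul_comm]
  ring

/-- `[h_r, h_s] = (J r, s) h_{r+s}`. -/
theorem h_lie {K : Type*} [Field K] {m : ℕ} (r s : Fin m ⊕ Fin m → ℤ) :
    ⁅h K m r, h K m s⁆ = (castVec K (J m *ᵥ r) ⬝ᵥ castVec K s) • h K m (r + s) := by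
  rw [h, h, D_lie, J_skew r s]
  change _ = _ • DLin K _ _
  rw [← map_smul, Matrix.mulVec_add, castVec_add, smul_add, neg_smul, sub_neg_eq_add, add_comm]
  rfl

theorem D_zero_lie_h {K : Type*} [Field K] {m : ℕ} (u : Fin m ⊕ Fin m → K)
    (r : Fin m ⊕ Fin m → ℤ) : ⁅D u 0, h K m r⁆ = (u ⬝ᵥ castVec K r) • h K m r := by
  rw [h, D_lie]
  change _ = _ • DLin K _ _
  rw [← map_smul, zero_add]
  change _ = D _ _
  have : castVec K (0 : Fin m ⊕ Fin m → ℤ) = 0 := by ext; simp [castVec]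
  rw [this, dotProduct_zero, zero_smul, sub_zero]

theorem D_zero_lie_D_zero {K : Type*} [Field K] {m : ℕ} (u v : Fin m ⊕ Fin m → K) :
    ⁅D u 0, D v 0⁆ = 0 := by
  have : castVec K (0 : Fin m ⊕ Fin m → ℤ) = 0 := by ext; simp [castVec]
  rw [D_lie, this]
  simp only [dotProduct_zero, zero_smul, sub_zero]
  exact map_zero (DLin K (0 + 0 : Fin m ⊕ Fin m → ℤ))

/-- The Hamiltonian Lie algebra `H_N = span {h_r : r ∈ ℤ^N} + 𝔥`, `N = 2m`, as a Lie subalgebra of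
the Witt algebra. -/
def Ham (K : Type*) [Field K] (m : ℕ) : LieSubalgebra K (Witt K (Fin m ⊕ Fin m)) where
  toSubmodule := Submodule.span K (Set.range (h K m)) ⊔ cartan K m
  lie_mem' := by
    intro x y hx hy
    change x ∈ Submodule.span K (Set.range (h K m)) ⊔ cartan K m at hx
    change y ∈ Submodule.span K (Set.range (h K m)) ⊔ cartan K m at hy
    change ⁅x, y⁆ ∈ Submodule.span K (Set.range (h K m)) ⊔ cartan K m
    have hh (r) : h K m r ∈ Submodule.span K (Set.range (h K m)) ⊔ cartan K m :=
      Submodule.mem_sup_left (Submodule.subset_span ⟨r, rfl⟩)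
    have key : Submodule.span K (Set.range (h K m)) ⊔ cartan K m =
        Submodule.span K (Set.range (h K m) ∪ Set.range fun u : Fin m ⊕ Fin m → K => D u 0) := by
      rw [Submodule.span_union, cartan_eq]
      congr 1
      exact (Submodule.span_eq (LinearMap.range (DLin K 0))).symm
    rw [key] at hx hy
    induction hx, hy using Submodule.span_induction₂ with
    | mem_mem x y hx hy =>
      rcases hx with ⟨r, rfl⟩ | ⟨u, rfl⟩ <;> rcases hy with ⟨s, rfl⟩ | ⟨v, rfl⟩
      · rw [h_lie]; exact Submodule.smul_mem _ _ (hh _)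
      · rw [← lie_skew, D_zero_lie_h]; exact Submodule.neg_mem _ (Submodule.smul_mem _ _ (hh _))
      · rw [D_zero_lie_h]; exact Submodule.smul_mem _ _ (hh _)
      · simp only [D_zero_lie_D_zero]; exact Submodule.zero_mem _
    | zero_left y _ =>
      rw [show ⁅(0 : Witt K (Fin m ⊕ Fin m)), y⁆ = 0 from zero_lie y]; exact Submodule.zero_mem _
    | zero_right x _ =>
      rw [show ⁅x, (0 : Witt K (Fin m ⊕ Fin m))⁆ = 0 from lie_zero x]; exact Submodule.zero_mem _
    | add_left x y z _ _ _ h1 h2 => rw [show ⁅x + y, z⁆ = ⁅x, z⁆ + ⁅y, z⁆ from add_lie x y z]; exact Submodule.add_mem _ h1 h2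
    | add_right x y z _ _ _ h1 h2 => rw [show ⁅x, y + z⁆ = ⁅x, y⁆ + ⁅x, z⁆ from lie_add x y z]; exact Submodule.add_mem _ h1 h2
    | smul_left a x y _ _ h1 => rw [show ⁅a • x, y⁆ = a • ⁅x, y⁆ from smul_lie a x y]; exact Submodule.smul_mem _ _ h1
    | smul_right a x y _ _ h1 => rw [show ⁅x, a • y⁆ = a • ⁅x, y⁆ from lie_smul a x y]; exact Submodule.smul_mem _ _ h1

/-- `h_r` as an element of `H_N`. -/
def hElt (K : Type*) [Field K] (m : ℕ) (r : Fin m ⊕ Fin m → ℤ) : Ham K m :=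
  ⟨h K m r, Submodule.mem_sup_left (Submodule.subset_span ⟨r, rfl⟩)⟩

/-- `D(u,0)` as an element of `H_N`. -/
def D0Elt {K : Type*} [Field K] {m : ℕ} (u : Fin m ⊕ Fin m → K) : Ham K m :=
  ⟨D u 0, Submodule.mem_sup_right (D_zero_mem_cartan u)⟩

/-- The derived subalgebra `H_N' = [H_N, H_N]`. -/
abbrev HamDer (K : Type*) [Field K] (m : ℕ) : LieIdeal K (Ham K m) :=
  ⁅(⊤ : LieIdeal K (Ham K m)), (⊤ : LieIdeal K (Ham K m))⁆

/-- The Cartan subalgebra `𝔥` as a subspace of `H_N`. -/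
def cartanHam (K : Type*) [Field K] (m : ℕ) : Submodule K (Ham K m) :=
  (cartan K m).comap (Ham K m).toSubmodule.subtype

/-! ### The groups -/

/-- The automorphism group of a Lie algebra: Lie algebra automorphisms under composition,
`(f * g) x = f (g x)`. -/
instance lieAutGroup (R L : Type*) [CommRing R] [LieRing L] [LieAlgebra R L] :
    Group (L ≃ₗ⁅R⁆ L) where
  mul f g := g.trans f
  one := 1
  inv f := f.symm
  mul_assoc _ _ _ := rfl
  one_mul _ := rfl
  mul_one _ := rfl
  inv_mul_cancel f := LieEquiv.self_trans_symm f

/-- The conformal symplectic group `GSp_N(ℤ)`, `N = 2m`: the `Q ∈ GL_N(ℤ)` with `Qᵀ J Q = ε J` for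
some unit `ε` of `ℤ`, i.e. `ε = ±1`. -/
def GSp (m : ℕ) : Subgroup (GL (Fin m ⊕ Fin m) ℤ) where
  carrier := {Q | ∃ ε : ℤˣ, Q.valᵀ * J m * Q.val = (ε : ℤ) • J m}
  one_mem' := ⟨1, by simp⟩
  mul_mem' := by
    rintro P Q ⟨ε, hε⟩ ⟨δ, hδ⟩
    refine ⟨ε * δ, ?_⟩
    calc _ = Q.valᵀ * (P.valᵀ * J m * P.val) * Q.val := by
          simp [Matrix.transpose_mul, Matrix.mul_assoc]
      _ = _ := by
          rw [hε, Matrix.mul_smul, Matrix.smul_mul, hδ, smul_smul, Units.val_mul]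
  inv_mem' := by
    rintro Q ⟨ε, hε⟩
    refine ⟨ε, ?_⟩
    have h1 : Q.val * (Q⁻¹).val = 1 := Units.mul_inv Q
    have h2 : ((Q⁻¹).val)ᵀ * Q.valᵀ = 1 := by rw [← Matrix.transpose_mul, h1, Matrix.transpose_one]
    have h3 : ((Q⁻¹).val)ᵀ * ((ε : ℤ) • J m) * (Q⁻¹).val = J m := by
      rw [← hε]
      calc _ = (((Q⁻¹).val)ᵀ * Q.valᵀ) * J m * (Q.val * (Q⁻¹).val) := by
            simp only [Matrix.mul_assoc]
        _ = _ := by rw [h1, h2, Matrix.one_mul, Matrix.mul_one]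
    rw [Matrix.mul_smul, Matrix.smul_mul] at h3
    conv_rhs => rw [← h3]
    rw [smul_smul, ← Units.val_mul, Int.units_mul_self, Units.val_one, one_smul]

/-- The monomial `λ^r = ∏ i, λ_i ^ r_i` for `λ ∈ (Kˣ)^N` and `r ∈ ℤ^N`. -/
def tpow {K ι : Type*} [Field K] [Fintype ι] (l : ι → Kˣ) (r : ι → ℤ) : Kˣ := ∏ i, l i ^ r i

theorem tpow_mul {K ι : Type*} [Field K] [Fintype ι] (l l' : ι → Kˣ) (r : ι → ℤ) :
    tpow (l * l') r = tpow l r * tpow l' r := by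
  simp [tpow, mul_zpow, Finset.prod_mul_distrib]

theorem tpow_mulVec {K ι : Type*} [Field K] [Fintype ι] [DecidableEq ι] (l : ι → Kˣ)
    (Q : Matrix ι ι ℤ) (r : ι → ℤ) :
    tpow (fun i => tpow l (Q *ᵥ Pi.single i 1)) r = tpow l (Q *ᵥ r) := by
  have h (i j : ι) : (Q *ᵥ Pi.single i 1) j = Q j i := by simp
  have hs (a : Kˣ) (t : Finset ι) (f : ι → ℤ) : ∏ j ∈ t, a ^ f j = a ^ ∑ j ∈ t, f j := by
    induction t using Finset.induction_on with
    | empty => simp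
    | insert j t hj ih => rw [Finset.prod_insert hj, Finset.sum_insert hj, zpow_add, ih]
  simp only [tpow, h, ← Finset.prod_zpow, ← zpow_mul]
  rw [Finset.prod_comm]
  refine Finset.prod_congr rfl fun i _ => ?_
  rw [hs]
  rfl

/-- The endomorphism `λ ↦ (λ^{Q e_i})_i` of the torus `(Kˣ)^N`. -/
def torusMap (K : Type*) {ι : Type*} [Field K] [Fintype ι] [DecidableEq ι] (Q : Matrix ι ι ℤ) :
    (ι → Kˣ) →* (ι → Kˣ) where
  toFun l i := tpow l (Q *ᵥ Pi.single i 1)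
  map_one' := by ext; simp [tpow]
  map_mul' l l' := by ext i; simp [tpow_mul]

theorem torusMap_comp {K ι : Type*} [Field K] [Fintype ι] [DecidableEq ι] (P Q : Matrix ι ι ℤ)
    (l : ι → Kˣ) : torusMap K P (torusMap K Q l) = torusMap K (Q * P) l := by
  funext i
  change tpow (fun j => tpow l (Q *ᵥ Pi.single j 1)) (P *ᵥ Pi.single i 1) =
    tpow l ((Q * P) *ᵥ Pi.single i 1)
  rw [tpow_mulVec, Matrix.mulVec_mulVec]

theorem torusMap_one {K ι : Type*} [Field K] [Fintype ι] [DecidableEq ι] (l : ι → Kˣ) :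
    torusMap K (1 : Matrix ι ι ℤ) l = l := by
  funext i
  change tpow l ((1 : Matrix ι ι ℤ) *ᵥ Pi.single i 1) = l i
  rw [Matrix.one_mulVec, tpow, Finset.prod_eq_single i]
  · simp
  · intro j _ hj; simp [Pi.single_eq_of_ne hj]
  · simp

/-- The action of `GSp_N(ℤ)` on the torus `(Kˣ)^N`: `(Q • λ)_i = λ^{Q⁻¹ e_i}`, so that
`(Q • λ)^r = λ^{Q⁻¹ r}`. -/
def torusAction (K : Type*) [Field K] (m : ℕ) : GSp m →* MulAut (Fin m ⊕ Fin m → Kˣ) where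
  toFun Q :=
    { torusMap K (Q⁻¹).val.val with
      invFun := torusMap K Q.val.val
      left_inv := by
        intro l
        change torusMap K Q.val.val (torusMap K (Q⁻¹).val.val l) = l
        rw [torusMap_comp, ← Units.val_mul, ← Subgroup.coe_mul, inv_mul_cancel]
        exact torusMap_one l
      right_inv := by
        intro l
        change torusMap K (Q⁻¹).val.val (torusMap K Q.val.val l) = l
        rw [torusMap_comp, ← Units.val_mul, ← Subgroup.coe_mul, mul_inv_cancel]
        exact torusMap_one l }
  map_one' := by
    ext1 l
    change torusMap K ((1 : GSp m)⁻¹).val.val l = l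
    rw [inv_one]
    exact torusMap_one l
  map_mul' P Q := by
    ext1 l
    change torusMap K ((P * Q)⁻¹).val.val l =
      torusMap K (P⁻¹).val.val (torusMap K (Q⁻¹).val.val l)
    rw [torusMap_comp, mul_inv_rev, Subgroup.coe_mul, Units.val_mul]

theorem torusAction_apply {K : Type*} [Field K] {m : ℕ} (Q : GSp m) (l : Fin m ⊕ Fin m → Kˣ)
    (i : Fin m ⊕ Fin m) :
    torusAction K m Q l i = tpow l ((Q⁻¹).val.val *ᵥ Pi.single i 1) := rfl

/-- The matrix `Q^{-T}` over `K`, for an integer matrix `Q ∈ GL_N(ℤ)`. -/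
def invTranspose (K : Type*) {ι : Type*} [Field K] [Fintype ι] [DecidableEq ι] (Q : GL ι ℤ) :
    Matrix ι ι K :=
  ((Q⁻¹).val.map (Int.cast : ℤ → K))ᵀ

end

end HamTorus

/-! The relations [h_r, h_s] = (Jr, s) h_{r+s} and [D(u,0), h_r] = (u, r) h_r, with h_0 = 0, show
that 𝔥 acts diagonally on H_N with one-dimensional root spaces K h_r for r ≠ 0. The subspace 𝔥 is
intrinsic, being the set of locally finite elements: an x with some nonzero component h_r has an
extremal one h_{r₀}, and iterating ad x on a suitable h_s produces the leading degrees s + k r₀ for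
all k (`IsLocallyFinite.eq_D0Elt`).

An automorphism σ therefore preserves 𝔥 and permutes its roots. The permutation is additive, hence
given by some Q in GL_N(ℤ), and σ(h_r) = c_r h_{Qr}. Comparing brackets gives c_r c_s (JQr, Qs) =
(Jr, s) c_{r+s} when r + s ≠ 0. Since the c_r are nonzero for r ≠ 0, Q preserves orthogonality,
which forces Qᵀ J Q = ±J (`mem_GSp_of_sympl_eq_zero`). With ε this sign, ε c_r is multiplicative on
non-orthogonal pairs, which forces a character of ℤ^N, that is, a point of the torus
(`map_add_of_sympl_ne_zero`). Conversely every pair (λ, Q) is realised by conjugating derivations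
with the algebra automorphism t^r ↦ λ^{Qr} t^{Qr}.

For the derived algebra the key fact is Der(H_N') = H_N (`adDerivationEquiv`), which rests on the
computation of homogeneous derivations in `eq_smul_sympl_of_cocycle`. An automorphism of H_N' acts
on derivations by conjugation and so extends to H_N; the extension is unique because H_N' has zero
centraliser in H_N. -/

open scoped Matrix

namespace HamTorus

noncomputable section

/-! ### The symplectic form on the lattice -/

/-- The symplectic form `(r, s) ↦ (J r, s)` on `ℤ^N`. -/
def sympl {m : ℕ} (r s : Fin m ⊕ Fin m → ℤ) : ℤ := (J m *ᵥ r) ⬝ᵥ s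

section Sympl

variable {m : ℕ}

theorem sympl_eq_sum (r s : Fin m ⊕ Fin m → ℤ) :
    sympl r s = ∑ i, (r (.inr i) * s (.inl i) - r (.inl i) * s (.inr i)) := by
  simp [sympl, J, dotProduct, Matrix.fromBlocks_mulVec, Matrix.neg_mulVec, sub_eq_add_neg,
    Finset.sum_add_distrib]

theorem sympl_add_left (r s t : Fin m ⊕ Fin m → ℤ) : sympl (r + s) t = sympl r t + sympl s t := by
  simp [sympl, Matrix.mulVec_add, add_dotProduct]

theorem sympl_add_right (r s t : Fin m ⊕ Fin m → ℤ) : sympl r (s + t) = sympl r s + sympl r t := by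
  simp [sympl, dotProduct_add]

theorem sympl_smul_right (a : ℤ) (r s : Fin m ⊕ Fin m → ℤ) : sympl r (a • s) = a * sympl r s := by
  rw [sympl, dotProduct_smul, smul_eq_mul]
  rfl

@[simp] theorem sympl_zero_left (r : Fin m ⊕ Fin m → ℤ) : sympl 0 r = 0 := by simp [sympl]

@[simp] theorem sympl_zero_right (r : Fin m ⊕ Fin m → ℤ) : sympl r 0 = 0 := by simp [sympl]

theorem sympl_skew (r s : Fin m ⊕ Fin m → ℤ) : sympl s r = -sympl r s := by
  simp only [sympl_eq_sum, ← Finset.sum_neg_distrib]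
  exact Finset.sum_congr rfl fun i _ => by ring

@[simp] theorem sympl_self (r : Fin m ⊕ Fin m → ℤ) : sympl r r = 0 := by
  have := sympl_skew r r
  omega

theorem sympl_neg_left (r s : Fin m ⊕ Fin m → ℤ) : sympl (-r) s = -sympl r s := by
  simp [sympl, Matrix.mulVec_neg]

theorem sympl_neg_right (r s : Fin m ⊕ Fin m → ℤ) : sympl r (-s) = -sympl r s := by
  simp [sympl]

theorem sympl_single_inl (r : Fin m ⊕ Fin m → ℤ) (i : Fin m) :
    sympl r (Pi.single (.inl i) 1) = r (.inr i) := by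
  simp [sympl, J, Matrix.fromBlocks_mulVec]

theorem sympl_single_inr (r : Fin m ⊕ Fin m → ℤ) (i : Fin m) :
    sympl r (Pi.single (.inr i) 1) = -r (.inl i) := by
  simp [sympl, J, Matrix.fromBlocks_mulVec, Matrix.neg_mulVec]

theorem exists_sympl_single_ne_zero {r : Fin m ⊕ Fin m → ℤ} (hr : r ≠ 0) :
    ∃ i, sympl r (Pi.single i 1) ≠ 0 := by
  obtain ⟨i, hi⟩ := Function.ne_iff.mp hr
  rcases i with i | i
  · exact ⟨.inr i, by rw [sympl_single_inr]; simpa using hi⟩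
  · exact ⟨.inl i, by rw [sympl_single_inl]; simpa using hi⟩

/-- Finitely many non-zero lattice vectors pair non-trivially with a common vector. -/
theorem exists_forall_sympl_ne_zero (S : Finset (Fin m ⊕ Fin m → ℤ)) :
    ∃ q, ∀ x ∈ S, x ≠ 0 → sympl x q ≠ 0 := by
  classical
  induction S using Finset.induction_on with
  | empty => exact ⟨0, by simp⟩
  | insert a S _ ih =>
    obtain ⟨q, hq⟩ := ih
    by_cases ha : a = 0 ∨ sympl a q ≠ 0
    · refine ⟨q, fun x hx hx0 => ?_⟩
      rcases Finset.mem_insert.mp hx with rfl | hx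
      · exact ha.resolve_left hx0
      · exact hq x hx hx0
    push Not at ha
    obtain ⟨i, hi⟩ := exists_sympl_single_ne_zero ha.1
    set p : Fin m ⊕ Fin m → ℤ := Pi.single i 1
    -- The new vector is k q + p. It is not orthogonal to a for any k, and each earlier x excludes
    -- at most one k, the solution of k (Jx, q) + (Jx, p) = 0.
    obtain ⟨k, hk⟩ := Infinite.exists_notMem_finset (S.image fun x => -sympl x p / sympl x q)
    refine ⟨k • q + p, fun x hx hx0 => ?_⟩
    rw [sympl_add_right, sympl_smul_right]
    rcases Finset.mem_insert.mp hx with rfl | hx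
    · rwa [ha.2, mul_zero, zero_add]
    · intro h0
      refine hk (Finset.mem_image.mpr ⟨x, hx, ?_⟩)
      exact Int.ediv_eq_of_eq_mul_left (hq x hx hx0) (by linarith)

/-- A map from the lattice to a commutative group which is multiplicative on the pairs that are not
orthogonal is a homomorphism. -/
theorem map_add_of_sympl_ne_zero {G : Type*} [CommGroup G] {f : (Fin m ⊕ Fin m → ℤ) → G}
    (h0 : f 0 = 1) (hf : ∀ r t, sympl r t ≠ 0 → f (r + t) = f r * f t)
    (r t : Fin m ⊕ Fin m → ℤ) : f (r + t) = f r * f t := by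
  classical
  by_cases hr : r = 0
  · simp [hr, h0]
  by_cases ht : t = 0
  · simp [ht, h0]
  by_cases hrt : sympl r t = 0
  swap
  · exact hf r t hrt
  -- An auxiliary q not orthogonal to the nonzero vectors among r, t, r + t allows f (r + t + q) to
  -- be expanded in two ways; f q then cancels.
  obtain ⟨q, hq⟩ := exists_forall_sympl_ne_zero {r, t, r + t}
  have h1 : f (r + t + q) = f r * (f t * f q) := by
    rw [add_assoc, hf, hf t q (hq t (by simp) ht)]
    rw [sympl_add_right, hrt, zero_add]
    exact hq r (by simp) hr
  have h2 : f (r + t + q) = f (r + t) * f q := by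
    by_cases h : r + t = 0
    · simp [h, h0]
    · exact hf _ _ (hq _ (by simp) h)
  rw [h2, ← mul_assoc] at h1
  exact mul_right_cancel h1

/-- Homogeneous derivations of degree `s ≠ 0` of the Lie algebra with basis `h_r`, `r ≠ 0`, are
inner, in terms of structure constants. -/
theorem eq_smul_sympl_of_cocycle {K : Type*} [Field K] [CharZero K] {s : Fin m ⊕ Fin m → ℤ}
    (hs : s ≠ 0) {f : (Fin m ⊕ Fin m → ℤ) → K} (hns : f (-s) = 0)
    (hf : ∀ r t, sympl r t * f (r + t) = f r * sympl (r + s) t + f t * sympl r (t + s)) :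
    ∃ c : K, ∀ r, f r = c * sympl s r := by
  -- Here f r is the coefficient in d h_r = f r • h_{r+s}, and `hf` is the Leibniz rule. Taking t =
  -- s and t = -s gives two shift rules, compatible only if f s = 0; hence f is invariant under
  -- translation by s off the hyperplane orthogonal to s.
  have hper (r) (hr : sympl s r ≠ 0) : f (r + s) = f r + 2 * f s := by
    have h := hf r s
    have hr' : (sympl r s : K) ≠ 0 := by
      rw [sympl_skew s r]; simpa using hr
    simp only [sympl_add_left, sympl_add_right, sympl_self, add_zero, Int.cast_add] at h
    apply mul_left_cancel₀ hr'
    linear_combination h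
  have hper' (r) (hr : sympl s r ≠ 0) : f (r + -s) = f r := by
    have h := hf r (-s)
    have hr' : (sympl r s : K) ≠ 0 := by
      rw [sympl_skew s r]; simpa using hr
    simp only [sympl_add_left, sympl_neg_right, sympl_self, add_zero, neg_add_cancel, hns,
      sympl_zero_right, Int.cast_neg] at h
    apply mul_left_cancel₀ hr'
    linear_combination -h
  obtain ⟨i, hi⟩ := exists_sympl_single_ne_zero hs
  have hfs : f s = 0 := by
    set p : Fin m ⊕ Fin m → ℤ := Pi.single i 1
    have h1 := hper p hi
    have h2 := hper' (p + s) (by rwa [sympl_add_right, sympl_self, add_zero])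
    rw [add_neg_cancel_right, h1] at h2
    have : (2 : K) * f s = 0 := by linear_combination -h2
    simpa using this
  simp only [hfs, mul_zero, add_zero] at hper
  -- Replacing t by t + s changes no value of f, so subtracting the two Leibniz rules gives f (r +
  -- t) = f r + f t. Put back into the rule, this makes f proportional to the pairing with s.
  have hcross (r t) (hr : sympl s r ≠ 0) (ht : sympl s t ≠ 0) (hrt : sympl s (r + t) ≠ 0) :
      f r * sympl s t = f t * sympl s r := by
    have h1 := hf r t
    have h2 := hf r (t + s)
    rw [← add_assoc, hper _ hrt, hper _ ht] at h2
    have hr' : (sympl r s : K) ≠ 0 := by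
      rw [sympl_skew s r]; simpa using hr
    have e : (sympl s r : K) = -sympl r s := by rw [sympl_skew r s]; simp
    simp only [sympl_add_left, sympl_add_right, sympl_self, Int.cast_add, add_zero] at h1 h2
    have h3 : f (r + t) = f r + f t := by
      apply mul_left_cancel₀ hr'
      linear_combination h2 - h1
    rw [h3] at h1
    rw [e]
    linear_combination -h1
  have hcross' (r t) (hr : sympl s r ≠ 0) (ht : sympl s t ≠ 0) :
      f r * sympl s t = f t * sympl s r := by
    by_cases hrt : sympl s (r + t) = 0
    -- When s is orthogonal to r + t, the vector 2r is an intermediary: s is orthogonal neither to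
    -- 3r nor to 2r + t.
    · have hrr : sympl s (r + r) ≠ 0 := by rw [sympl_add_right]; omega
      have h1 := hcross r (r + r) hr hrr (by simp only [sympl_add_right]; omega)
      have h2 := hcross (r + r) t hrr ht (by simp only [sympl_add_right] at hrt ⊢; omega)
      have hr' : (sympl s r : K) ≠ 0 := by simpa using hr
      simp only [sympl_add_right, Int.cast_add] at h1 h2
      have h3 : f (r + r) = f r + f r := by
        apply mul_left_cancel₀ hr'
        linear_combination -h1
      rw [h3] at h2
      have : (2 : K) * (f r * sympl s t) = 2 * (f t * sympl s r) := by linear_combination h2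
      exact mul_left_cancel₀ two_ne_zero this
    · exact hcross r t hr ht hrt
  have hi' : (sympl s (Pi.single i 1) : K) ≠ 0 := by simpa using hi
  have hne (r) (hr : sympl s r ≠ 0) :
      f r = f (Pi.single i 1) / sympl s (Pi.single i 1) * sympl s r := by
    field_simp
    exact hcross' r _ hr hi
  refine ⟨f (Pi.single i 1) / sympl s (Pi.single i 1), fun r => ?_⟩
  by_cases hr : sympl s r = 0
  swap
  · exact hne r hr
  rw [hr, Int.cast_zero, mul_zero]
  by_cases hrs : r + s = 0
  · rwa [eq_neg_of_add_eq_zero_left hrs]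
  -- For r orthogonal to s, a t orthogonal neither to s nor to r + s makes f t and f (r + t) known,
  -- and the Leibniz rule reduces to f r * (J(r + s), t) = 0.
  obtain ⟨t, ht⟩ := exists_forall_sympl_ne_zero {r + s, s}
  have hst := ht s (by simp) hs
  have hrst : (sympl (r + s) t : K) ≠ 0 := by simpa using ht _ (by simp) hrs
  have h := hf r t
  rw [hne t hst, hne (r + t) (by rwa [sympl_add_right, hr, zero_add])] at h
  have e : sympl r s = 0 := by rw [sympl_skew s r, hr, neg_zero]
  simp only [sympl_add_right, hr, e, add_zero, zero_add] at h
  have : f r * sympl (r + s) t = 0 := by linear_combination -h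
  exact (mul_eq_zero.mp this).resolve_right hrst

end Sympl

/-! ### Additive maps of the lattice and matrices preserving orthogonality -/

section Lattice

theorem map_eq_sum_single {ι A : Type*} [Fintype ι] [DecidableEq ι] [AddCommGroup A]
    (F : (ι → ℤ) →+ A) (r : ι → ℤ) : F r = ∑ i, r i • F (Pi.single i 1) := by
  conv_lhs => rw [pi_eq_sum_univ' r]
  rw [map_sum]
  refine Finset.sum_congr rfl fun i _ => ?_
  rw [← map_zsmul]

theorem eq_tpow_of_map_add {K ι : Type*} [Field K] [Fintype ι] [DecidableEq ι]
    {f : (ι → ℤ) → Kˣ} (hf : ∀ r s, f (r + s) = f r * f s) (r : ι → ℤ) :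
    f r = tpow (fun i => f (Pi.single i 1)) r :=
  map_eq_sum_single (A := Additive Kˣ) (AddMonoidHom.mk' f hf) r

theorem eq_dotProduct_of_map_add {K ι : Type*} [Field K] [Fintype ι] [DecidableEq ι]
    {f : (ι → ℤ) → K} (hf : ∀ r s, f (r + s) = f r + f s) (r : ι → ℤ) :
    f r = (fun i => f (Pi.single i 1)) ⬝ᵥ castVec K r := by
  rw [dotProduct]
  refine (map_eq_sum_single (AddMonoidHom.mk' f hf) r).trans
    (Finset.sum_congr rfl fun i _ => ?_)
  rw [zsmul_eq_mul, mul_comm]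
  rfl

/-- An additive map of the lattice is multiplication by an integer matrix. -/
theorem exists_mulVec_of_map_add {ι : Type*} [Fintype ι] [DecidableEq ι]
    {q : (ι → ℤ) → ι → ℤ} (hq : ∀ r s, q (r + s) = q r + q s) :
    ∃ Q : Matrix ι ι ℤ, ∀ r, q r = Q *ᵥ r :=
  ⟨LinearMap.toMatrix' (AddMonoidHom.mk' q hq).toIntLinearMap, fun r => by
    rw [LinearMap.toMatrix'_mulVec]; rfl⟩

variable {m : ℕ}

theorem J_apply_eq_sympl (i j : Fin m ⊕ Fin m) :
    J m i j = sympl (Pi.single j 1) (Pi.single i 1) := by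
  simp [sympl]

theorem transpose_mul_J_mul_apply (Q : Matrix (Fin m ⊕ Fin m) (Fin m ⊕ Fin m) ℤ)
    (i j : Fin m ⊕ Fin m) :
    (Qᵀ * J m * Q) i j = sympl (Q *ᵥ Pi.single j 1) (Q *ᵥ Pi.single i 1) := by
  rw [sympl, Matrix.dotProduct_mulVec, ← Matrix.mulVec_transpose, Matrix.mulVec_mulVec,
    Matrix.mulVec_mulVec]
  simp

theorem sympl_mulVec_mulVec {Q : Matrix (Fin m ⊕ Fin m) (Fin m ⊕ Fin m) ℤ} {e : ℤ}
    (hQ : Qᵀ * J m * Q = e • J m) (r s : Fin m ⊕ Fin m → ℤ) :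
    sympl (Q *ᵥ r) (Q *ᵥ s) = e * sympl r s := by
  rw [sympl, Matrix.dotProduct_mulVec, ← Matrix.mulVec_transpose, Matrix.mulVec_mulVec,
    Matrix.mulVec_mulVec, hQ,
    Matrix.smul_mulVec, smul_dotProduct, smul_eq_mul, sympl]

/-- An element of `GL_N(ℤ)` preserving orthogonality preserves the symplectic form up to sign. -/
theorem mem_GSp_of_sympl_eq_zero {Q : GL (Fin m ⊕ Fin m) ℤ}
    (h : ∀ r s, sympl r s = 0 → sympl (Q.val *ᵥ r) (Q.val *ᵥ s) = 0) : Q ∈ GSp m := by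
  rcases m with _ | m
  · exact ⟨1, by ext i; exact isEmptyElim i⟩
  have main : ∃ k : ℤ, Q.valᵀ * J (m + 1) * Q.val = k • J (m + 1) := by
    let b (i j : Fin (m + 1) ⊕ Fin (m + 1)) : ℤ :=
      sympl (Q.val *ᵥ Pi.single i 1) (Q.val *ᵥ Pi.single j 1)
    have hb (i j) (hij : sympl (Pi.single i 1) (Pi.single j 1) = 0) : b i j = 0 := h _ _ hij
    have hdiag (a : Fin (m + 1)) : b (.inl a) (.inr a) = b (.inl 0) (.inr 0) := by
      by_cases ha : a = 0
      · rw [ha]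
      -- With e and f the two halves of the standard basis, e_a + e_0 and f_a - f_0 are orthogonal
      -- because their two diagonal pairings cancel. Preserving this relation forces the diagonal
      -- values of the transformed form to agree.
      have h1 := h (Pi.single (.inl a) 1 + Pi.single (.inl 0) 1)
        (Pi.single (.inr a) 1 - Pi.single (.inr 0) 1) (by
          simp [sub_eq_add_neg, sympl_add_right, sympl_neg_right, sympl_single_inr, ha, Ne.symm ha])
      have h2 : b (.inl a) (.inr 0) = 0 := hb _ _ (by simp [sympl_single_inr, ha])
      have h3 : b (.inl 0) (.inr a) = 0 := hb _ _ (by simp [sympl_single_inr, ha])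
      simp only [b] at h2 h3 ⊢
      simp only [sub_eq_add_neg, Matrix.mulVec_add, Matrix.mulVec_neg, sympl_add_right,
        sympl_add_left, sympl_neg_right] at h1
      linarith
    refine ⟨-b (.inl 0) (.inr 0), ?_⟩
    ext i j
    rw [transpose_mul_J_mul_apply, Matrix.smul_apply, smul_eq_mul, J_apply_eq_sympl]
    change b j i = _
    by_cases hij : sympl (Pi.single j 1) (Pi.single i 1) = 0
    · rw [hb j i hij, hij, mul_zero]
    rcases i with i | i <;> rcases j with j | j
    · simp [sympl_single_inl] at hij
    · have : j = i := by
        by_contra hne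
        simp [sympl_single_inl, Ne.symm hne] at hij
      subst this
      have e : b (.inr j) (.inl j) = -b (.inl j) (.inr j) := sympl_skew _ _
      rw [e, hdiag]
      simp [sympl_single_inl]
    · have : j = i := by
        by_contra hne
        simp [sympl_single_inr, Ne.symm hne] at hij
      subst this
      rw [hdiag]
      simp [sympl_single_inr]
    · simp [sympl_single_inr] at hij
  obtain ⟨k, hk⟩ := main
  have hJ : J (m + 1) * J (m + 1) = -1 := by
    simp [J, Matrix.fromBlocks_multiply, ← Matrix.fromBlocks_one, Matrix.fromBlocks_neg]
  -- Both Q and J are invertible over ℤ, so k J is invertible, and one entry of the identity k J B =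
  -- 1 shows that k divides 1.
  have hQ : IsUnit (Q.valᵀ * J (m + 1) * Q.val) := by
    refine IsUnit.mul (IsUnit.mul ?_ ?_) Q.isUnit
    · exact (Matrix.isUnit_transpose _).mpr Q.isUnit
    · exact IsUnit.of_mul_eq_one (-J (m + 1)) (by rw [mul_neg, hJ, neg_neg])
  rw [hk] at hQ
  obtain ⟨B, hB⟩ := hQ.exists_right_inv
  rw [Matrix.smul_mul] at hB
  have hk1 : k * (J (m + 1) * B) (.inl 0) (.inl 0) = 1 := by
    simpa using congr_fun₂ hB (.inl 0) (.inl 0)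
  have hu : IsUnit k := IsUnit.of_mul_eq_one _ hk1
  exact ⟨hu.unit, by rw [hk, IsUnit.unit_spec]⟩

end Lattice

/-! ### Coordinates on the Hamiltonian algebra -/

section Coordinates

variable {K : Type*} [Field K] {m : ℕ}

/-- The vector `u` of the component `D(u,r)` of degree `r` of a derivation. -/
def vcoeff (K : Type*) {ι : Type*} [Field K] [DecidableEq ι] (r : ι → ℤ) :
    Witt K ι →ₗ[K] ι → K where
  toFun X i := (X (AddMonoidAlgebra.single (Pi.single i 1) 1)).coeff (r + Pi.single i 1)
  map_add' X Y := by ext i; simp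
  map_smul' a X := by ext i; simp

theorem vcoeff_D {ι : Type*} [Fintype ι] [DecidableEq ι] (u : ι → K) (r s : ι → ℤ) :
    vcoeff K r (D u s) = if s = r then u else 0 := by
  ext i
  change (D u s (AddMonoidAlgebra.single (Pi.single i 1) 1)).coeff (r + Pi.single i 1) = _
  have : u ⬝ᵥ castVec K (Pi.single i 1 : ι → ℤ) = u i := by
    rw [show castVec K (Pi.single i 1 : ι → ℤ) = Pi.single i 1 by
      ext j; by_cases h : j = i <;> simp [castVec, h]]
    simp
  rw [D_single, this, mul_one, AddMonoidAlgebra.coeff_single, Finsupp.single_apply]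
  by_cases h : s = r <;> simp [h]

theorem castVec_injective [CharZero K] {ι : Type*} :
    Function.Injective (castVec K : (ι → ℤ) → ι → K) := fun r s h => by
  ext i
  exact Int.cast_injective (congr_fun h i)

@[simp] theorem castVec_zero {ι : Type*} : castVec K (0 : ι → ℤ) = 0 := by
  ext; simp [castVec]

theorem castVec_dotProduct_castVec {ι : Type*} [Fintype ι] (r s : ι → ℤ) :
    castVec K r ⬝ᵥ castVec K s = ((r ⬝ᵥ s : ℤ) : K) := by
  simp [castVec, dotProduct]

theorem castVec_J_dotProduct (r s : Fin m ⊕ Fin m → ℤ) :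
    castVec K (J m *ᵥ r) ⬝ᵥ castVec K s = (sympl r s : K) :=
  castVec_dotProduct_castVec _ _

theorem dotProduct_castVec_ext {ι : Type*} [Fintype ι] [DecidableEq ι] {u v : ι → K}
    (h : ∀ r, u ⬝ᵥ castVec K r = v ⬝ᵥ castVec K r) : u = v := by
  ext i
  have e : castVec K (Pi.single i 1 : ι → ℤ) = Pi.single i 1 := by
    ext j; by_cases h : j = i <;> simp [castVec, h]
  simpa [e] using h (Pi.single i 1)

theorem J_mulVec_ne_zero {r : Fin m ⊕ Fin m → ℤ} (hr : r ≠ 0) : J m *ᵥ r ≠ 0 := fun h => by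
  obtain ⟨i, hi⟩ := exists_sympl_single_ne_zero hr
  exact hi (by rw [sympl, h]; exact zero_dotProduct _)

@[simp] theorem hElt_zero : hElt K m 0 = 0 := by
  apply Subtype.ext
  change D (castVec K (J m *ᵥ (0 : Fin m ⊕ Fin m → ℤ))) 0 = 0
  rw [Matrix.mulVec_zero, castVec_zero]
  exact map_zero (DLin (ι := Fin m ⊕ Fin m) K 0)

theorem D0Elt_add (u v : Fin m ⊕ Fin m → K) :
    (D0Elt (u + v) : Ham K m) = D0Elt u + D0Elt v :=
  Subtype.ext (map_add (DLin K 0) u v)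

theorem D0Elt_smul (a : K) (u : Fin m ⊕ Fin m → K) :
    (D0Elt (a • u) : Ham K m) = a • D0Elt u :=
  Subtype.ext (map_smul (DLin K 0) a u)

theorem D0Elt_zero : (D0Elt 0 : Ham K m) = 0 :=
  Subtype.ext (map_zero (DLin (ι := Fin m ⊕ Fin m) K 0))

theorem hElt_lie_hElt (r s : Fin m ⊕ Fin m → ℤ) :
    ⁅hElt K m r, hElt K m s⁆ = (sympl r s : K) • hElt K m (r + s) := by
  rw [← castVec_J_dotProduct]
  exact Subtype.ext (h_lie r s)

theorem D0Elt_lie_hElt (u : Fin m ⊕ Fin m → K) (r : Fin m ⊕ Fin m → ℤ) :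
    ⁅(D0Elt u : Ham K m), hElt K m r⁆ = (u ⬝ᵥ castVec K r) • hElt K m r :=
  Subtype.ext (D_zero_lie_h u r)

theorem hElt_lie_D0Elt (u : Fin m ⊕ Fin m → K) (r : Fin m ⊕ Fin m → ℤ) :
    ⁅hElt K m r, (D0Elt u : Ham K m)⁆ = -((u ⬝ᵥ castVec K r) • hElt K m r) := by
  rw [← lie_skew, D0Elt_lie_hElt]

theorem D0Elt_lie_D0Elt (u v : Fin m ⊕ Fin m → K) : ⁅(D0Elt u : Ham K m), D0Elt v⁆ = 0 :=
  Subtype.ext (D_zero_lie_D_zero u v)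

theorem Ham.span_eq_top :
    Submodule.span K (Set.range (hElt K m) ∪ Set.range (D0Elt (K := K) (m := m))) = ⊤ := by
  rw [eq_top_iff]
  have hinj : Function.Injective (Ham K m).toSubmodule.subtype := Subtype.val_injective
  rw [← Submodule.map_le_map_iff_of_injective hinj, Submodule.map_span, Set.image_union,
    ← Set.range_comp, ← Set.range_comp, Submodule.map_top, Submodule.range_subtype]
  change Submodule.span K (Set.range (h K m)) ⊔ cartan K m ≤ _
  refine sup_le (Submodule.span_mono Set.subset_union_left) ?_
  rw [cartan_eq]
  rintro _ ⟨u, rfl⟩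
  exact Submodule.subset_span (Or.inr ⟨u, rfl⟩)

theorem Ham.linearMap_ext {M : Type*} [AddCommGroup M] [Module K M] {f g : Ham K m →ₗ[K] M}
    (hh : ∀ r, f (hElt K m r) = g (hElt K m r)) (hd : ∀ u, f (D0Elt u) = g (D0Elt u)) :
    f = g := by
  apply LinearMap.ext_on Ham.span_eq_top
  rintro _ (⟨r, rfl⟩ | ⟨u, rfl⟩)
  · exact hh r
  · exact hd u

/-- The coefficient of `h_r` of an element of `H_N`; it is zero for `r = 0`. -/
def hcoeff (K : Type*) [Field K] {m : ℕ} (r : Fin m ⊕ Fin m → ℤ) : Ham K m →ₗ[K] K where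
  -- For r ≠ 0 the component of degree r is a multiple of Jr, and pairing with Jr recovers the
  -- multiple; in characteristic zero the divisor is nonzero, being a positive sum of integer
  -- squares. For r = 0 the quotient is 0 / 0 = 0.
  toFun x := (vcoeff K r x ⬝ᵥ castVec K (J m *ᵥ r)) /
    (castVec K (J m *ᵥ r) ⬝ᵥ castVec K (J m *ᵥ r))
  map_add' x y := by simp [add_dotProduct, add_div]
  map_smul' a x := by simp [mul_div_assoc]

/-- The vector `u` of the component `D(u,0)` of an element of `H_N`. -/
def dcoeff (K : Type*) [Field K] (m : ℕ) : Ham K m →ₗ[K] Fin m ⊕ Fin m → K :=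
  vcoeff K 0 ∘ₗ (Ham K m).toSubmodule.subtype

@[simp] theorem hcoeff_zero (x : Ham K m) : hcoeff K 0 x = 0 := by
  change (_ ⬝ᵥ castVec K (J m *ᵥ (0 : Fin m ⊕ Fin m → ℤ))) / (_ : K) = 0
  rw [Matrix.mulVec_zero, castVec_zero, dotProduct_zero, zero_div]

theorem hcoeff_hElt [CharZero K] {r : Fin m ⊕ Fin m → ℤ} (hr : r ≠ 0) (s : Fin m ⊕ Fin m → ℤ) :
    hcoeff K r (hElt K m s) = if s = r then 1 else 0 := by
  change vcoeff K r (D (castVec K (J m *ᵥ s)) s) ⬝ᵥ _ / _ = _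
  rw [vcoeff_D]
  by_cases h : s = r
  · subst h
    simp only [if_true]
    apply div_self
    rw [castVec_dotProduct_castVec, Int.cast_ne_zero]
    exact fun h0 => J_mulVec_ne_zero hr (dotProduct_self_eq_zero.mp h0)
  · simp [h]

@[simp] theorem hcoeff_D0Elt (r : Fin m ⊕ Fin m → ℤ) (u : Fin m ⊕ Fin m → K) :
    hcoeff K r (D0Elt u) = 0 := by
  by_cases hr : r = 0
  · subst hr; simp
  change vcoeff K r (D u 0) ⬝ᵥ _ / _ = _
  rw [vcoeff_D, if_neg (Ne.symm hr), zero_dotProduct, zero_div]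

@[simp] theorem dcoeff_hElt (r : Fin m ⊕ Fin m → ℤ) : dcoeff K m (hElt K m r) = 0 := by
  change vcoeff K 0 (D (castVec K (J m *ᵥ r)) r) = 0
  rw [vcoeff_D]
  by_cases hr : r = 0 <;> simp [hr]

@[simp] theorem dcoeff_D0Elt (u : Fin m ⊕ Fin m → K) : dcoeff K m (D0Elt u) = u := by
  change vcoeff K 0 (D u 0) = u
  rw [vcoeff_D, if_pos rfl]

theorem D0Elt_injective : Function.Injective (D0Elt : (Fin m ⊕ Fin m → K) → Ham K m) :=
  fun u v h => by rw [← dcoeff_D0Elt u, h, dcoeff_D0Elt]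

theorem hElt_ne_zero [CharZero K] {r : Fin m ⊕ Fin m → ℤ} (hr : r ≠ 0) : hElt K m r ≠ 0 :=
  fun h => by
    have := hcoeff_hElt (K := K) hr r
    rw [h, map_zero, if_pos rfl] at this
    exact zero_ne_one this

/-- The expansion of an element of `H_N` in the spanning set. -/
theorem Ham.exists_eq_sum [CharZero K] (x : Ham K m) : ∃ S : Finset (Fin m ⊕ Fin m → ℤ),
    (∀ r, r ∈ S ↔ hcoeff K r x ≠ 0) ∧
    x = D0Elt (dcoeff K m x) + ∑ r ∈ S, hcoeff K r x • hElt K m r := by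
  classical
  suffices hx : ∃ S : Finset (Fin m ⊕ Fin m → ℤ), (∀ r, hcoeff K r x ≠ 0 → r ∈ S) ∧
      x = D0Elt (dcoeff K m x) + ∑ r ∈ S, hcoeff K r x • hElt K m r by
    obtain ⟨S, hS, hx⟩ := hx
    refine ⟨S.filter fun r => hcoeff K r x ≠ 0, fun r => ?_, ?_⟩
    · rw [Finset.mem_filter, and_iff_right_iff_imp]; exact hS r
    · rw [Finset.sum_filter_of_ne (fun r _ h => left_ne_zero_of_smul h)]; exact hx
  have key (S T : Finset (Fin m ⊕ Fin m → ℤ)) (hST : S ⊆ T) (y : Ham K m)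
      (hS : ∀ r, hcoeff K r y ≠ 0 → r ∈ S) :
      ∑ r ∈ T, hcoeff K r y • hElt K m r = ∑ r ∈ S, hcoeff K r y • hElt K m r := by
    refine (Finset.sum_subset hST fun r _ hr => ?_).symm
    rw [show hcoeff K r y = 0 by by_contra h; exact hr (hS r h), zero_smul]
  have hmem : x ∈ Submodule.span K
      (Set.range (hElt K m) ∪ Set.range (D0Elt (K := K) (m := m))) := by
    rw [Ham.span_eq_top]; trivial
  induction hmem using Submodule.span_induction with
  | mem x hx =>
    rcases hx with ⟨s, rfl⟩ | ⟨u, rfl⟩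
    · refine ⟨{s}, fun r hr => ?_, ?_⟩
      · by_cases hr0 : r = 0
        · simp [hr0] at hr
        · rw [hcoeff_hElt hr0] at hr
          simp only [ne_eq, ite_eq_right_iff, one_ne_zero, imp_false, not_not] at hr
          simp [hr]
      · rw [Finset.sum_singleton, dcoeff_hElt, D0Elt_zero, zero_add]
        by_cases hs : s = 0
        · simp [hs]
        · rw [hcoeff_hElt hs, if_pos rfl, one_smul]
    · exact ⟨∅, by simp, by simp⟩
  | zero => exact ⟨∅, by simp, by simp [D0Elt_zero]⟩
  | add x y _ _ hx hy =>
    obtain ⟨S, hS, hx⟩ := hx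
    obtain ⟨T, hT, hy⟩ := hy
    refine ⟨S ∪ T, fun r hr => ?_, ?_⟩
    · rw [Finset.mem_union]
      by_contra h
      push Not at h
      apply hr
      rw [map_add, show hcoeff K r x = 0 by by_contra h'; exact h.1 (hS r h'),
        show hcoeff K r y = 0 by by_contra h'; exact h.2 (hT r h'), add_zero]
    · simp only [map_add, add_smul, Finset.sum_add_distrib, D0Elt_add]
      rw [key S _ Finset.subset_union_left x hS, key T _ Finset.subset_union_right y hT]
      conv_lhs => rw [hx, hy]
      abel
  | smul a x _ hx =>
    obtain ⟨S, hS, hx⟩ := hx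
    refine ⟨S, fun r hr => hS r fun h0 => hr (by rw [map_smul, h0, smul_zero]), ?_⟩
    conv_lhs => rw [hx]
    simp only [map_smul, D0Elt_smul, smul_add, Finset.smul_sum, smul_smul, smul_eq_mul]

theorem Ham.eq_D0Elt [CharZero K] {x : Ham K m} (hx : ∀ r, hcoeff K r x = 0) :
    x = D0Elt (dcoeff K m x) := by
  obtain ⟨S, -, hS⟩ := Ham.exists_eq_sum x
  rw [Finset.sum_eq_zero fun r _ => by rw [hx, zero_smul], add_zero] at hS
  exact hS

theorem Ham.ext_coeff [CharZero K] {x y : Ham K m} (hd : dcoeff K m x = dcoeff K m y)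
    (hh : ∀ r, hcoeff K r x = hcoeff K r y) : x = y := by
  rw [← sub_eq_zero, Ham.eq_D0Elt (x := x - y) fun r => by rw [map_sub, hh, sub_self], map_sub, hd,
    sub_self, D0Elt_zero]

/-- Degree zero could only be reached by [h_r, h_{-r}], a multiple of h_0 = 0, or by brackets inside
the commutative 𝔥. -/
theorem dcoeff_lie [CharZero K] (x y : Ham K m) : dcoeff K m ⁅x, y⁆ = 0 := by
  obtain ⟨S, -, hS⟩ := Ham.exists_eq_sum x
  obtain ⟨T, -, hT⟩ := Ham.exists_eq_sum y
  rw [hS, hT]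
  simp only [add_lie, lie_add, sum_lie, lie_sum, smul_lie, lie_smul, hElt_lie_hElt,
    hElt_lie_D0Elt, D0Elt_lie_hElt, D0Elt_lie_D0Elt, map_add, map_sum, map_smul, map_zero,
    map_neg, dcoeff_hElt, smul_zero, neg_zero, Finset.sum_const_zero, add_zero]

theorem hcoeff_D0Elt_lie [CharZero K] (u : Fin m ⊕ Fin m → K) (x : Ham K m)
    (r : Fin m ⊕ Fin m → ℤ) :
    hcoeff K r ⁅D0Elt u, x⁆ = (u ⬝ᵥ castVec K r) * hcoeff K r x := by
  by_cases hr : r = 0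
  · subst hr; simp
  obtain ⟨S, -, hS⟩ := Ham.exists_eq_sum x
  rw [hS]
  simp only [lie_add, lie_sum, lie_smul, D0Elt_lie_hElt, D0Elt_lie_D0Elt, map_add, map_sum,
    map_smul, hcoeff_D0Elt, hcoeff_hElt hr, smul_eq_mul, zero_add, Finset.mul_sum]
  refine Finset.sum_congr rfl fun s _ => ?_
  by_cases h : s = r
  · subst h; simp [mul_comm]
  · simp [h]

theorem hcoeff_hElt_lie [CharZero K] (s r : Fin m ⊕ Fin m → ℤ) {x : Ham K m}
    (hx : dcoeff K m x = 0) :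
    hcoeff K r ⁅hElt K m s, x⁆ = sympl s r * hcoeff K (r - s) x := by
  by_cases hr : r = 0
  · subst hr; simp
  obtain ⟨S, -, hS⟩ := Ham.exists_eq_sum x
  rw [hx, D0Elt_zero, zero_add] at hS
  rw [hS]
  simp only [lie_sum, lie_smul, map_sum, map_smul, Finset.mul_sum, hElt_lie_hElt, smul_eq_mul,
    hcoeff_hElt hr]
  refine Finset.sum_congr rfl fun t _ => ?_
  by_cases hrs : r - s = 0
  · rw [hrs, hcoeff_zero, sub_eq_zero.mp hrs]
    by_cases ht : t = 0 <;> simp [ht]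
  rw [hcoeff_hElt hrs]
  by_cases h : t = r - s
  · subst h
    simp [sub_eq_add_neg, sympl_add_right, sympl_neg_right]
    ring
  · rw [if_neg h, if_neg fun h' => h (eq_sub_of_add_eq' h')]
    simp

/-- An element of `H_N` is in the derived algebra iff it has no component in `𝔥`. -/
theorem mem_HamDer_iff [CharZero K] {x : Ham K m} : x ∈ HamDer K m ↔ dcoeff K m x = 0 := by
  have hh (r) : hElt K m r ∈ HamDer K m := by
    by_cases hr : r = 0
    · rw [hr, hElt_zero]; exact zero_mem _
    -- D(r,0) acts on h_r by the scalar (r, r), nonzero in characteristic zero, so h_r is itself a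
    -- multiple of a bracket.
    have e : ⁅(D0Elt (castVec K r) : Ham K m), hElt K m r⁆ ∈ HamDer K m :=
      LieSubmodule.lie_mem_lie (LieSubmodule.mem_top _) (LieSubmodule.mem_top _)
    rw [D0Elt_lie_hElt] at e
    have h0 : castVec K r ⬝ᵥ castVec K r ≠ 0 := by
      rw [castVec_dotProduct_castVec, Int.cast_ne_zero]
      exact fun h0 => hr (dotProduct_self_eq_zero.mp h0)
    have := (HamDer K m).smul_mem (castVec K r ⬝ᵥ castVec K r)⁻¹ e
    rwa [smul_smul, inv_mul_cancel₀ h0, one_smul] at this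
  constructor
  · intro hx
    have hle : (HamDer K m).toSubmodule ≤ LinearMap.ker (dcoeff K m) := by
      rw [LieSubmodule.lieIdeal_oper_eq_linear_span', Submodule.span_le]
      rintro _ ⟨y, -, z, -, rfl⟩
      exact dcoeff_lie y z
    exact hle hx
  · intro hx
    obtain ⟨S, -, hS⟩ := Ham.exists_eq_sum x
    rw [hx, D0Elt_zero, zero_add] at hS
    rw [hS]
    exact sum_mem fun r _ => (HamDer K m).smul_mem _ (hh r)

theorem mem_cartanHam_iff [CharZero K] {x : Ham K m} :
    x ∈ cartanHam K m ↔ ∃ u, x = D0Elt u := by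
  change (x : Witt K (Fin m ⊕ Fin m)) ∈ cartan K m ↔ _
  rw [cartan_eq]
  constructor
  · rintro ⟨u, hu⟩
    exact ⟨u, Subtype.ext hu.symm⟩
  · rintro ⟨u, rfl⟩
    exact ⟨u, rfl⟩

end Coordinates

/-! ### Locally finite elements -/

/-- An element of a Lie algebra is locally finite if every element lies in a finite-dimensional
subspace stable under its adjoint action. -/
def IsLocallyFinite (K : Type*) {L : Type*} [Field K] [LieRing L] [LieAlgebra K L] (x : L) : Prop :=
  ∀ y : L, ∃ W : Submodule K L, W.FG ∧ y ∈ W ∧ ∀ w ∈ W, ⁅x, w⁆ ∈ W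

theorem IsLocallyFinite.map {K L L' : Type*} [Field K] [LieRing L] [LieAlgebra K L] [LieRing L']
    [LieAlgebra K L'] {x : L} (hx : IsLocallyFinite K x) (σ : L ≃ₗ⁅K⁆ L') :
    IsLocallyFinite K (σ x) := fun y => by
  obtain ⟨W, hW, hy, hxW⟩ := hx (σ.symm y)
  refine ⟨W.map (σ.toLinearEquiv : L →ₗ[K] L'), hW.map _, ⟨_, hy, σ.apply_symm_apply y⟩, ?_⟩
  rintro _ ⟨w, hw, rfl⟩
  exact ⟨⁅x, w⁆, hxW w hw, σ.map_lie x w⟩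

section

variable {K : Type*} [Field K] {m : ℕ}

theorem isLocallyFinite_D0Elt (u : Fin m ⊕ Fin m → K) :
    IsLocallyFinite K (D0Elt u : Ham K m) := by
  intro y
  have hy : y ∈ Submodule.span K
      (Set.range (hElt K m) ∪ Set.range (D0Elt (K := K) (m := m))) := by
    rw [Ham.span_eq_top]; trivial
  have heig (z : Ham K m) (a : K) (hz : ⁅(D0Elt u : Ham K m), z⁆ = a • z) :
      ∃ W : Submodule K (Ham K m), W.FG ∧ z ∈ W ∧ ∀ w ∈ W, ⁅(D0Elt u : Ham K m), w⁆ ∈ W := by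
    refine ⟨K ∙ z, Submodule.fg_span_singleton z, Submodule.mem_span_singleton_self z, ?_⟩
    intro w hw
    obtain ⟨b, rfl⟩ := Submodule.mem_span_singleton.mp hw
    rw [lie_smul, hz]
    exact Submodule.smul_mem _ _ (Submodule.smul_mem _ _ (Submodule.mem_span_singleton_self z))
  induction hy using Submodule.span_induction with
  | mem y hy =>
    rcases hy with ⟨r, rfl⟩ | ⟨v, rfl⟩
    · exact heig _ _ (D0Elt_lie_hElt u r)
    · exact heig _ 0 (by rw [D0Elt_lie_D0Elt, zero_smul])
  | zero => exact heig 0 0 (by simp)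
  | add y z _ _ hy hz =>
    obtain ⟨W, hW, hyW, hW'⟩ := hy
    obtain ⟨V, hV, hzV, hV'⟩ := hz
    refine ⟨W ⊔ V, hW.sup hV, Submodule.add_mem_sup hyW hzV, fun w hw => ?_⟩
    obtain ⟨a, ha, b, hb, rfl⟩ := Submodule.mem_sup.mp hw
    rw [lie_add]
    exact Submodule.add_mem_sup (hW' a ha) (hV' b hb)
  | smul a y _ hy =>
    obtain ⟨W, hW, hyW, hW'⟩ := hy
    exact ⟨W, hW, W.smul_mem a hyW, hW'⟩

/-- The supports of the elements of a finite-dimensional subspace are bounded. -/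
theorem exists_bound_of_fg [CharZero K] {W : Submodule K (Ham K m)} (hW : W.FG)
    (φ : (Fin m ⊕ Fin m → ℤ) → ℤ) : ∃ B, ∀ w ∈ W, ∀ t, hcoeff K t w ≠ 0 → φ t ≤ B := by
  classical
  have hb (w : Ham K m) : ∃ B, ∀ t, hcoeff K t w ≠ 0 → φ t ≤ B := by
    obtain ⟨S, hS, -⟩ := Ham.exists_eq_sum w
    obtain ⟨B, hB⟩ := (S.image φ).exists_le
    exact ⟨B, fun t ht => hB _ (Finset.mem_image_of_mem φ ((hS t).mpr ht))⟩
  choose b hb using hb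
  obtain ⟨T, rfl⟩ := hW
  obtain ⟨B, hB⟩ := (T.image b).exists_le
  refine ⟨B, fun w hw => ?_⟩
  induction hw using Submodule.span_induction with
  | mem w hw => exact fun t ht => (hb w t ht).trans (hB _ (Finset.mem_image_of_mem b hw))
  | zero => intro t ht; simp at ht
  | add x y _ _ hx hy =>
    intro t ht
    by_cases h : hcoeff K t x = 0
    · exact hy t fun h' => ht (by rw [map_add, h, h', add_zero])
    · exact hx t h
  | smul a x _ hx => exact fun t ht => hx t fun h => ht (by rw [map_smul, h, smul_zero])

theorem hcoeff_lie [CharZero K] (x : Ham K m) {y : Ham K m} (hy : dcoeff K m y = 0)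
    {S : Finset (Fin m ⊕ Fin m → ℤ)}
    (hS : x = D0Elt (dcoeff K m x) + ∑ r ∈ S, hcoeff K r x • hElt K m r)
    (t : Fin m ⊕ Fin m → ℤ) :
    hcoeff K t ⁅x, y⁆ = (dcoeff K m x ⬝ᵥ castVec K t) * hcoeff K t y +
      ∑ r ∈ S, hcoeff K r x * (sympl r t * hcoeff K (t - r) y) := by
  conv_lhs => rw [hS]
  simp only [add_lie, sum_lie, smul_lie, map_add, map_sum, map_smul, hcoeff_D0Elt_lie,
    hcoeff_hElt_lie _ _ hy, smul_eq_mul]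

/-- A locally finite element of `H_N` lies in `𝔥`. -/
theorem IsLocallyFinite.eq_D0Elt [CharZero K] {x : Ham K m} (hx : IsLocallyFinite K x) :
    x = D0Elt (dcoeff K m x) := by
  classical
  obtain ⟨S, hS, hxS⟩ := Ham.exists_eq_sum x
  rcases S.eq_empty_or_nonempty with rfl | hne
  · simpa using hxS
  exfalso
  obtain ⟨r₀, hr₀, hmax⟩ := S.exists_max_image (fun r => r ⬝ᵥ r) hne
  have hr₀x : hcoeff K r₀ x ≠ 0 := (hS r₀).mp hr₀
  have hr₀0 : r₀ ≠ 0 := by rintro rfl; simp at hr₀x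
  have hpos : ∀ v : Fin m ⊕ Fin m → ℤ, v ≠ 0 → 0 < v ⬝ᵥ v := fun v hv =>
    lt_of_le_of_ne (Finset.sum_nonneg fun i _ => mul_self_nonneg _)
      fun h => hv (dotProduct_self_eq_zero.mp h.symm)
  -- Expanding |r - r₀|² > 0 and using |r| ≤ |r₀| shows that r₀ is the only point of the support
  -- where the linear form (r₀, ·) is maximal.
  have hlt : ∀ r ∈ S, r ≠ r₀ → r₀ ⬝ᵥ r < r₀ ⬝ᵥ r₀ := by
    intro r hr hrr
    have h1 := hpos (r - r₀) (sub_ne_zero.mpr hrr)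
    rw [sub_dotProduct, dotProduct_sub, dotProduct_sub, dotProduct_comm r r₀] at h1
    have h2 := hmax r hr
    linarith
  obtain ⟨i, hi⟩ := exists_sympl_single_ne_zero hr₀0
  set s : Fin m ⊕ Fin m → ℤ := Pi.single i 1
  have hs0 : s ≠ 0 := by intro h; rw [h] at hi; simp at hi
  obtain ⟨W, hW, hsW, hxW⟩ := hx (hElt K m s)
  -- W contains elements whose leading term for (r₀, ·) is h_{s + k r₀}. Each bracket with x
  -- multiplies the leading coefficient by hcoeff r₀ x * (Jr₀, s), which does not vanish.
  have iter : ∀ k : ℕ, ∃ w ∈ W, dcoeff K m w = 0 ∧ hcoeff K (s + k • r₀) w ≠ 0 ∧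
      ∀ t, r₀ ⬝ᵥ (s + k • r₀) ≤ r₀ ⬝ᵥ t → t ≠ s + k • r₀ → hcoeff K t w = 0 := by
    intro k
    induction k with
    | zero =>
      refine ⟨_, hsW, dcoeff_hElt s, ?_, fun t _ hts => ?_⟩
      · rw [zero_smul, add_zero, hcoeff_hElt hs0, if_pos rfl]
        exact one_ne_zero
      · rw [zero_smul, add_zero] at hts
        by_cases ht : t = 0
        · simp [ht]
        · rw [hcoeff_hElt ht, if_neg (Ne.symm hts)]
    | succ k ih =>
      obtain ⟨w, hwW, hdw, hne, hzero⟩ := ih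
      have hp := hpos r₀ hr₀0
      -- At this height only h_{r₀} contributes: the 𝔥-part and every other h_r would need a
      -- coefficient of w above its leading term.
      have hstep (t) (ht : r₀ ⬝ᵥ (s + (k + 1) • r₀) ≤ r₀ ⬝ᵥ t) :
          hcoeff K t ⁅x, w⁆ = hcoeff K r₀ x * (sympl r₀ t * hcoeff K (t - r₀) w) := by
        have ht' : r₀ ⬝ᵥ (s + k • r₀) + r₀ ⬝ᵥ r₀ ≤ r₀ ⬝ᵥ t := by
          rw [succ_nsmul, ← add_assoc, dotProduct_add] at ht
          exact ht
        have hz : ∀ v, r₀ ⬝ᵥ (s + k • r₀) < r₀ ⬝ᵥ v → hcoeff K v w = 0 := fun v hv =>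
          hzero v hv.le (by rintro rfl; exact lt_irrefl _ hv)
        rw [hcoeff_lie x hdw hxS, hz t (by linarith), mul_zero, zero_add]
        refine Finset.sum_eq_single r₀ (fun r hr hrr => ?_) (fun h => absurd hr₀ h)
        rw [hz (t - r), mul_zero, mul_zero]
        have := hlt r hr hrr
        rw [dotProduct_sub]
        linarith
      refine ⟨⁅x, w⁆, hxW w hwW, dcoeff_lie x w, ?_, fun t ht hne' => ?_⟩
      · rw [hstep _ le_rfl]
        have e : s + (k + 1) • r₀ - r₀ = s + k • r₀ := by rw [succ_nsmul]; abel
        have e' : sympl r₀ (s + (k + 1) • r₀) = sympl r₀ s := by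
          rw [sympl_add_right, ← natCast_zsmul, sympl_smul_right, sympl_self, mul_zero, add_zero]
        rw [e, e']
        exact mul_ne_zero hr₀x (mul_ne_zero (by simpa using hi) hne)
      · rw [hstep t ht, hzero (t - r₀), mul_zero, mul_zero]
        · rw [succ_nsmul, ← add_assoc, dotProduct_add] at ht
          rw [dotProduct_sub]
          linarith
        · intro h
          apply hne'
          rw [succ_nsmul, ← add_assoc, ← h, sub_add_cancel]
  obtain ⟨B, hB⟩ := exists_bound_of_fg hW (fun t => r₀ ⬝ᵥ t)
  -- Since (r₀, r₀) ≥ 1, this many steps push the leading term beyond the bound B for the supports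
  -- in W.
  obtain ⟨w, hwW, -, hne, -⟩ := iter (B - r₀ ⬝ᵥ s + 1).toNat
  have h1 : r₀ ⬝ᵥ (s + _) ≤ B := hB w hwW _ hne
  have hp := hpos r₀ hr₀0
  rw [dotProduct_add, dotProduct_smul, nsmul_eq_mul] at h1
  have h2 := Int.self_le_toNat (B - r₀ ⬝ᵥ s + 1)
  nlinarith

/-- Local finiteness is invariant under automorphisms and characterises 𝔥, so 𝔥 is preserved. -/
theorem exists_map_D0Elt [CharZero K] (σ : Ham K m ≃ₗ⁅K⁆ Ham K m) (u : Fin m ⊕ Fin m → K) :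
    σ (D0Elt u) = D0Elt (dcoeff K m (σ (D0Elt u))) :=
  ((isLocallyFinite_D0Elt u).map σ).eq_D0Elt

end

/-! ### The shape of an automorphism -/

section

variable {K : Type*} [Field K] {m : ℕ}

theorem invTranspose_mulVec_dotProduct {ι : Type*} [Fintype ι] [DecidableEq ι] (Q : GL ι ℤ)
    (u : ι → K) (r : ι → ℤ) :
    (invTranspose K Q *ᵥ u) ⬝ᵥ castVec K r = u ⬝ᵥ castVec K ((Q⁻¹).val *ᵥ r) := by
  have : castVec K ((Q⁻¹).val *ᵥ r) = (Q⁻¹).val.map (Int.cast : ℤ → K) *ᵥ castVec K r := by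
    ext i; simp [castVec, Matrix.mulVec, dotProduct]
  rw [this, invTranspose, Matrix.mulVec_transpose, Matrix.dotProduct_mulVec]

theorem GL_inv_mulVec_mulVec {ι : Type*} [Fintype ι] [DecidableEq ι] (Q : GL ι ℤ) (r : ι → ℤ) :
    (Q⁻¹).val *ᵥ (Q.val *ᵥ r) = r := by
  rw [Matrix.mulVec_mulVec, ← Units.val_mul, inv_mul_cancel, Units.val_one, Matrix.one_mulVec]

theorem GL_mulVec_inv_mulVec {ι : Type*} [Fintype ι] [DecidableEq ι] (Q : GL ι ℤ) (r : ι → ℤ) :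
    Q.val *ᵥ ((Q⁻¹).val *ᵥ r) = r := by
  rw [Matrix.mulVec_mulVec, ← Units.val_mul, mul_inv_cancel, Units.val_one, Matrix.one_mulVec]

theorem tpow_torusAction (Q : GSp m) (l : Fin m ⊕ Fin m → Kˣ) (r : Fin m ⊕ Fin m → ℤ) :
    tpow (torusAction K m Q l) r = tpow l ((Q⁻¹).val.val *ᵥ r) :=
  tpow_mulVec l _ r

theorem GSp.exists_sympl (Q : GSp m) : ∃ ε : ℤˣ, ∀ r s,
    sympl (Q.val.val *ᵥ r) (Q.val.val *ᵥ s) = ε * sympl r s := by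
  obtain ⟨ε, hε⟩ := Q.2
  exact ⟨ε, sympl_mulVec_mulVec hε⟩

/-- Qᵀ J Q = ε J rewrites as Q⁻ᵀ J = ε J Q because ε² = 1. This identity links the two descriptions
of σ(h_r), as a derivation D and as a multiple of h_{Qr}. -/
theorem invTranspose_mulVec_J {Q : GL (Fin m ⊕ Fin m) ℤ} {ε : ℤˣ}
    (hε : ∀ r s, sympl (Q.val *ᵥ r) (Q.val *ᵥ s) = ε * sympl r s) (r : Fin m ⊕ Fin m → ℤ) :
    invTranspose K Q *ᵥ castVec K (J m *ᵥ r) =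
      ((ε : ℤ) : K) • castVec K (J m *ᵥ (Q.val *ᵥ r)) := by
  apply dotProduct_castVec_ext
  intro t
  rw [invTranspose_mulVec_dotProduct, castVec_J_dotProduct, smul_dotProduct, castVec_J_dotProduct]
  conv_rhs => rw [← GL_mulVec_inv_mulVec Q t, hε]
  rw [smul_eq_mul, ← Int.cast_mul, ← mul_assoc, ← Units.val_mul, Int.units_mul_self, Units.val_one,
    one_mul]

theorem D_invTranspose {Q : GL (Fin m ⊕ Fin m) ℤ} {ε : ℤˣ}
    (hε : ∀ r s, sympl (Q.val *ᵥ r) (Q.val *ᵥ s) = ε * sympl r s) (r : Fin m ⊕ Fin m → ℤ) :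
    D (invTranspose K Q *ᵥ castVec K (J m *ᵥ r)) (Q.val *ᵥ r) =
      ((ε : ℤ) : K) • h K m (Q.val *ᵥ r) := by
  rw [invTranspose_mulVec_J hε]
  exact map_smul (DLin K (Q.val *ᵥ r)) _ _

variable [CharZero K]

theorem dcoeff_symm_map_D0Elt (σ : Ham K m ≃ₗ⁅K⁆ Ham K m) (u : Fin m ⊕ Fin m → K) :
    dcoeff K m (σ.symm (D0Elt (dcoeff K m (σ (D0Elt u))))) = u := by
  rw [← exists_map_D0Elt, LieEquiv.symm_apply_apply, dcoeff_D0Elt]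

theorem dcoeff_map_symm_D0Elt (σ : Ham K m ≃ₗ⁅K⁆ Ham K m) (u : Fin m ⊕ Fin m → K) :
    dcoeff K m (σ (D0Elt (dcoeff K m (σ.symm (D0Elt u))))) = u :=
  dcoeff_symm_map_D0Elt σ.symm u

/-- σ is onto 𝔥, so agreement of the two weights on σ(𝔥) is agreement on all of K^N, and ℤ embeds in
K. -/
theorem root_unique (σ : Ham K m ≃ₗ⁅K⁆ Ham K m) {t t' : Fin m ⊕ Fin m → ℤ}
    (h : ∀ u, dcoeff K m (σ (D0Elt u)) ⬝ᵥ castVec K t =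
      dcoeff K m (σ (D0Elt u)) ⬝ᵥ castVec K t') : t = t' := by
  apply castVec_injective (K := K)
  apply dotProduct_eq
  intro v
  rw [dotProduct_comm, dotProduct_comm _ v, ← dcoeff_map_symm_D0Elt σ v]
  exact h _

theorem map_hElt_ne_zero (σ : Ham K m ≃ₗ⁅K⁆ Ham K m) {r : Fin m ⊕ Fin m → ℤ} (hr : r ≠ 0) :
    σ (hElt K m r) ≠ 0 := fun h =>
  hElt_ne_zero (K := K) hr (by rw [← σ.symm_apply_apply (hElt K m r), h, map_zero])

/-- An automorphism maps root vectors of `𝔥` to root vectors. -/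
theorem exists_map_hElt (σ : Ham K m ≃ₗ⁅K⁆ Ham K m) (r : Fin m ⊕ Fin m → ℤ) :
    ∃ t, (∀ u, dcoeff K m (σ (D0Elt u)) ⬝ᵥ castVec K t = u ⬝ᵥ castVec K r) ∧
      ∃ c : K, σ (hElt K m r) = c • hElt K m t := by
  by_cases hr : r = 0
  · subst hr
    exact ⟨0, by simp, 0, by simp⟩
  set y := σ (hElt K m r) with hy
  have hy0 : y ≠ 0 := map_hElt_ne_zero σ hr
  have hlie (u) : ⁅(D0Elt (dcoeff K m (σ (D0Elt u))) : Ham K m), y⁆ =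
      (u ⬝ᵥ castVec K r) • y := by
    rw [← exists_map_D0Elt, hy, ← LieEquiv.map_lie, D0Elt_lie_hElt, map_smul]
  -- y is a nonzero multiple of a bracket, since D(r,0) has eigenvalue (r, r) ≠ 0 on h_r; brackets
  -- have no 𝔥-part.
  have hdy : dcoeff K m y = 0 := by
    have h1 := congrArg (dcoeff K m) (hlie (castVec K r))
    rw [dcoeff_lie, map_smul, castVec_dotProduct_castVec] at h1
    refine (smul_eq_zero.mp h1.symm).resolve_left ?_
    rw [Int.cast_eq_zero]
    exact fun h0 => hr (dotProduct_self_eq_zero.mp h0)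
  have hroot (t) (ht : hcoeff K t y ≠ 0) (u) :
      dcoeff K m (σ (D0Elt u)) ⬝ᵥ castVec K t = u ⬝ᵥ castVec K r := by
    have h1 := congrArg (hcoeff K t) (hlie u)
    rw [hcoeff_D0Elt_lie, map_smul, smul_eq_mul] at h1
    exact mul_right_cancel₀ ht h1
  obtain ⟨t, ht⟩ : ∃ t, hcoeff K t y ≠ 0 := by
    by_contra! h
    exact hy0 (Ham.ext_coeff (by rw [hdy, map_zero]) fun r => by rw [h, map_zero])
  refine ⟨t, hroot t ht, hcoeff K t y, Ham.ext_coeff ?_ fun t' => ?_⟩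
  · rw [hdy, map_smul, dcoeff_hElt, smul_zero]
  · by_cases ht0 : t' = 0
    · simp [ht0]
    rw [map_smul, hcoeff_hElt ht0]
    by_cases htt : t = t'
    · simp [htt]
    · rw [if_neg htt, smul_zero]
      by_contra h
      exact htt (root_unique σ fun u => by rw [hroot t ht, hroot t' h])

/-- A priori σ restricted to 𝔥 is only K-linear. Integrality comes from the roots: they form the
lattice, and the map on them is additive because a root is determined by its values. -/
theorem exists_matrix_map_hElt (σ : Ham K m ≃ₗ⁅K⁆ Ham K m) :
    ∃ Q : Matrix (Fin m ⊕ Fin m) (Fin m ⊕ Fin m) ℤ,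
      (∀ r u, dcoeff K m (σ (D0Elt u)) ⬝ᵥ castVec K (Q *ᵥ r) = u ⬝ᵥ castVec K r) ∧
      ∀ r, ∃ c : K, σ (hElt K m r) = c • hElt K m (Q *ᵥ r) := by
  choose q hq hc using exists_map_hElt σ
  obtain ⟨Q, hQ⟩ := exists_mulVec_of_map_add (q := q) fun r s =>
    root_unique σ fun u => by
      rw [hq, castVec_add, castVec_add, dotProduct_add, dotProduct_add, hq, hq]
  simp only [hQ] at hq hc
  exact ⟨Q, hq, hc⟩

theorem exists_GL_map_hElt (σ : Ham K m ≃ₗ⁅K⁆ Ham K m) :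
    ∃ Q : GL (Fin m ⊕ Fin m) ℤ, (∀ u, σ (D0Elt u) = D0Elt (invTranspose K Q *ᵥ u)) ∧
      ∀ r, ∃ c : K, σ (hElt K m r) = c • hElt K m (Q.val *ᵥ r) := by
  have hcomp (τ : Ham K m ≃ₗ⁅K⁆ Ham K m) (P P' : Matrix (Fin m ⊕ Fin m) (Fin m ⊕ Fin m) ℤ)
      (hP : ∀ r u, dcoeff K m (τ (D0Elt u)) ⬝ᵥ castVec K (P *ᵥ r) = u ⬝ᵥ castVec K r)
      (hP' : ∀ r u, dcoeff K m (τ.symm (D0Elt u)) ⬝ᵥ castVec K (P' *ᵥ r) =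
        u ⬝ᵥ castVec K r) : P * P' = 1 := by
    apply Matrix.mulVec_injective
    funext r
    apply root_unique τ
    intro u
    rw [← Matrix.mulVec_mulVec, hP, Matrix.one_mulVec,
      ← hP' r (dcoeff K m (τ (D0Elt u))), dcoeff_symm_map_D0Elt]
  obtain ⟨P, hP, hc⟩ := exists_matrix_map_hElt σ
  obtain ⟨P', hP', -⟩ := exists_matrix_map_hElt σ.symm
  let Q : GL (Fin m ⊕ Fin m) ℤ := ⟨P, P', hcomp σ P P' hP hP', hcomp σ.symm P' P hP' hP⟩
  refine ⟨Q, fun u => ?_, hc⟩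
  rw [exists_map_D0Elt]
  congr 1
  apply dotProduct_castVec_ext
  intro r
  have e : P *ᵥ ((Q⁻¹).val *ᵥ r) = r := GL_mulVec_inv_mulVec Q r
  rw [invTranspose_mulVec_dotProduct, ← hP ((Q⁻¹).val *ᵥ r) u, e]

/-- Every automorphism of `H_N` is given by an element of `GSp_N(ℤ)` and a point of the torus. -/
theorem exists_GSp_torus_map (σ : Ham K m ≃ₗ⁅K⁆ Ham K m) :
    ∃ (Q : GSp m) (l : Fin m ⊕ Fin m → Kˣ),
      (∀ r, (σ (hElt K m r) : Witt K (Fin m ⊕ Fin m)) = (tpow l (Q.val.val *ᵥ r) : K) •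
        D (invTranspose K Q.val *ᵥ castVec K (J m *ᵥ r)) (Q.val.val *ᵥ r)) ∧
      ∀ u, σ (D0Elt u) = D0Elt (invTranspose K Q.val *ᵥ u) := by
  classical
  obtain ⟨Q, hQ, hc⟩ := exists_GL_map_hElt σ
  choose c hc using hc
  have hQ0 {r} (hr : r ≠ 0) : Q.val *ᵥ r ≠ 0 := fun h => hr (by
    rw [← GL_inv_mulVec_mulVec Q r, h, Matrix.mulVec_zero])
  have hc0 {r} (hr : r ≠ 0) : c r ≠ 0 := fun h => map_hElt_ne_zero σ hr (by
    rw [hc, h, zero_smul])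
  -- This is σ applied to [h_r, h_s]; r + s ≠ 0 is needed to compare coefficients of a nonzero
  -- vector.
  have hmul {r s} (hrs : r + s ≠ 0) :
      c r * c s * sympl (Q.val *ᵥ r) (Q.val *ᵥ s) = sympl r s * c (r + s) := by
    have h1 := congrArg σ (hElt_lie_hElt (K := K) r s)
    rw [LieEquiv.map_lie, map_smul, hc, hc, hc, smul_lie, lie_smul, hElt_lie_hElt,
      ← Matrix.mulVec_add, smul_smul, smul_smul, smul_smul] at h1
    exact smul_left_injective K (hElt_ne_zero (hQ0 hrs)) h1
  have hmem : Q ∈ GSp m := mem_GSp_of_sympl_eq_zero fun r s h0 => by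
    by_cases hr : r = 0
    · simp [hr]
    by_cases hs : s = 0
    · simp [hs]
    by_cases hrs : r + s = 0
    · rw [eq_neg_of_add_eq_zero_left hrs, Matrix.mulVec_neg, sympl_neg_left, sympl_self, neg_zero]
    · have h1 := hmul hrs
      rw [h0, Int.cast_zero, zero_mul] at h1
      simpa [hc0 hr, hc0 hs] using h1
  obtain ⟨ε, hε⟩ := GSp.exists_sympl ⟨Q, hmem⟩
  have hεε : ((ε : ℤ) : K) * ((ε : ℤ) : K) = 1 := by
    rw [← Int.cast_mul, ← Units.val_mul, Int.units_mul_self, Units.val_one, Int.cast_one]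
  have hε0 : ((ε : ℤ) : K) ≠ 0 := left_ne_zero_of_mul_eq_one hεε
  -- The scalars satisfy ε c_r c_s = c_{r+s} on non-orthogonal pairs, so ε c_r is multiplicative
  -- there. The value at 0 must be imposed: h_0 = 0 leaves c 0 undetermined.
  let f (r : Fin m ⊕ Fin m → ℤ) : Kˣ :=
    if hr : r = 0 then 1 else Units.mk0 (((ε : ℤ) : K) * c r) (mul_ne_zero hε0 (hc0 hr))
  have hfne {r} (hr : r ≠ 0) : (f r : K) = ((ε : ℤ) : K) * c r := by simp [f, hr]
  have hf (r s) (hrs : sympl r s ≠ 0) : f (r + s) = f r * f s := by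
    have hr : r ≠ 0 := by rintro rfl; simp at hrs
    have hs : s ≠ 0 := by rintro rfl; simp at hrs
    have h0 : r + s ≠ 0 := fun h => hrs (by
      rw [eq_neg_of_add_eq_zero_left h, sympl_neg_left, sympl_self, neg_zero])
    have h1 := hmul h0
    have hrs' : (sympl r s : K) ≠ 0 := by simpa using hrs
    rw [hε, Int.cast_mul] at h1
    ext
    rw [Units.val_mul, hfne hr, hfne hs, hfne h0]
    apply mul_left_cancel₀ hrs'
    linear_combination -((ε : ℤ) : K) * h1
  have hfadd := map_add_of_sympl_ne_zero (f := f) (by simp [f]) hf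
  -- The target formula carries λ^{Qr} where the character gives f r, so λ is the image under Q of
  -- the point (f e_i)_i.
  refine ⟨⟨Q, hmem⟩, torusAction K m ⟨Q, hmem⟩ fun i => f (Pi.single i 1), fun r => ?_, hQ⟩
  have e : ((⟨Q, hmem⟩ : GSp m)⁻¹).val.val *ᵥ (Q.val *ᵥ r) = r := GL_inv_mulVec_mulVec Q r
  rw [tpow_torusAction, e, ← eq_tpow_of_map_add hfadd, D_invTranspose hε]
  by_cases hr : r = 0
  · subst hr
    have : h K m 0 = 0 := congrArg Subtype.val (hElt_zero (K := K) (m := m))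
    rw [hElt_zero, map_zero, Matrix.mulVec_zero, this, smul_zero, smul_zero]
    rfl
  rw [hc, hfne hr, smul_smul, mul_right_comm, hεε, one_mul]
  rfl

end

/-! ### Automorphisms from the semidirect product -/

section

/-- The derivation `θ X θ⁻¹`, for an algebra automorphism `θ`. -/
def conjDerivation {K A : Type*} [Field K] [CommRing A] [Algebra K A] (θ : A ≃ₐ[K] A)
    (X : Derivation K A A) : Derivation K A A :=
  Derivation.mk' (θ.toLinearMap ∘ₗ X.toLinearMap ∘ₗ θ.symm.toLinearMap) fun a b => by simp

theorem conjDerivation_apply {K A : Type*} [Field K] [CommRing A] [Algebra K A] (θ : A ≃ₐ[K] A)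
    (X : Derivation K A A) (a : A) : conjDerivation θ X a = θ (X (θ.symm a)) := rfl

/-- Conjugation of derivations by an algebra automorphism. -/
def derivationConj {K A : Type*} [Field K] [CommRing A] [Algebra K A] (θ : A ≃ₐ[K] A) :
    Derivation K A A →ₗ⁅K⁆ Derivation K A A where
  toFun := conjDerivation θ
  map_add' X Y := by ext a; simp [conjDerivation_apply]
  map_smul' c X := by ext a; simp [conjDerivation_apply]
  map_lie' {X Y} := by ext a; simp [conjDerivation_apply, Derivation.commutator_apply]

theorem derivationConj_apply {K A : Type*} [Field K] [CommRing A] [Algebra K A] (θ : A ≃ₐ[K] A)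
    (X : Derivation K A A) (a : A) : derivationConj θ X a = θ (X (θ.symm a)) := rfl

variable {K : Type*} [Field K] {m : ℕ}

theorem tpow_add {ι : Type*} [Fintype ι] (l : ι → Kˣ) (r s : ι → ℤ) :
    tpow l (r + s) = tpow l r * tpow l s := by
  simp [tpow, zpow_add, Finset.prod_mul_distrib]

theorem tpow_zero {ι : Type*} [Fintype ι] (l : ι → Kˣ) : tpow l 0 = 1 := by simp [tpow]

/-- The endomorphism `t^r ↦ λ^{Qr} t^{Qr}` of the Laurent polynomials. -/
def laurentHom {ι : Type*} [Fintype ι] (l : ι → Kˣ) (Q : Matrix ι ι ℤ) :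
    Laurent K ι →ₐ[K] Laurent K ι :=
  AddMonoidAlgebra.lift K (Laurent K ι) (ι → ℤ)
    { toFun := fun r => AddMonoidAlgebra.single (Q *ᵥ r.toAdd) (tpow l (Q *ᵥ r.toAdd) : K)
      map_one' := by
        change AddMonoidAlgebra.single (Q *ᵥ (0 : ι → ℤ)) (tpow l (Q *ᵥ (0 : ι → ℤ)) : K) = 1
        rw [Matrix.mulVec_zero, tpow_zero]
        rfl
      map_mul' := fun r s => by
        rw [AddMonoidAlgebra.single_mul_single, toAdd_mul, Matrix.mulVec_add, tpow_add,
          Units.val_mul] }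

theorem laurentHom_single {ι : Type*} [Fintype ι] (l : ι → Kˣ) (Q : Matrix ι ι ℤ) (r : ι → ℤ)
    (c : K) : laurentHom l Q (AddMonoidAlgebra.single r c) =
      AddMonoidAlgebra.single (Q *ᵥ r) (c * tpow l (Q *ᵥ r)) := by
  rw [laurentHom, AddMonoidAlgebra.lift_single]
  simp

theorem laurentHom_comp_eq_id {ι : Type*} [Fintype ι] [DecidableEq ι] {l l' : ι → Kˣ}
    {Q Q' : Matrix ι ι ℤ} (hQ : Q * Q' = 1)
    (hl : ∀ r, tpow l' (Q' *ᵥ r) * tpow l r = 1) :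
    (laurentHom l Q).comp (laurentHom l' Q') = AlgHom.id K (Laurent K ι) := by
  refine AddMonoidAlgebra.algHom_ext (fun r => ?_) (Subsingleton.elim _ _)
  rw [AlgHom.comp_apply, laurentHom_single, laurentHom_single, Matrix.mulVec_mulVec, hQ,
    Matrix.one_mulVec, one_mul, ← Units.val_mul, hl]
  rfl

/-- The automorphism `t^r ↦ λ^{Qr} t^{Qr}` of the Laurent polynomials. -/
def laurentEquiv {ι : Type*} [Fintype ι] [DecidableEq ι] (l : ι → Kˣ) (Q : GL ι ℤ) :
    Laurent K ι ≃ₐ[K] Laurent K ι :=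
  -- The inverse sends t^r to λ^{-r} t^{Q⁻¹r}. Its torus parameter μ must satisfy μ^{Q⁻¹r} = λ^{-r},
  -- that is, μ^r = λ^{-Qr}.
  AlgEquiv.ofAlgHom (laurentHom l Q.val) (laurentHom (torusMap K Q.val l)⁻¹ (Q⁻¹).val)
    (laurentHom_comp_eq_id (Units.mul_inv Q) fun r => by
      have : tpow (torusMap K Q.val l) ((Q⁻¹).val *ᵥ r) = tpow l r := by
        conv_rhs => rw [← GL_mulVec_inv_mulVec Q r]
        exact tpow_mulVec l _ _
      rw [← this, ← tpow_mul, inv_mul_cancel]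
      simp [tpow])
    (laurentHom_comp_eq_id (Units.inv_mul Q) fun r => by
      have : tpow (torusMap K Q.val l) r = tpow l (Q.val *ᵥ r) := tpow_mulVec l _ _
      rw [← this, ← tpow_mul, mul_inv_cancel]
      simp [tpow])

theorem laurentEquiv_single {ι : Type*} [Fintype ι] [DecidableEq ι] (l : ι → Kˣ) (Q : GL ι ℤ)
    (r : ι → ℤ) (c : K) : laurentEquiv l Q (AddMonoidAlgebra.single r c) =
      AddMonoidAlgebra.single (Q.val *ᵥ r) (c * tpow l (Q.val *ᵥ r)) :=
  laurentHom_single l Q.val r c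

theorem laurentEquiv_symm_single {ι : Type*} [Fintype ι] [DecidableEq ι] (l : ι → Kˣ) (Q : GL ι ℤ)
    (r : ι → ℤ) (c : K) : (laurentEquiv l Q).symm (AddMonoidAlgebra.single r c) =
      AddMonoidAlgebra.single ((Q⁻¹).val *ᵥ r) (c * (tpow l r)⁻¹) := by
  rw [AlgEquiv.symm_apply_eq, laurentEquiv_single, GL_mulVec_inv_mulVec, mul_assoc]
  simp

/-- On t^n the inverse substitution yields the factor (u, Q⁻¹n) = (Q⁻ᵀu, n), and the torus factors
λ^{-n} and λ^{Qr+n} combine to λ^{Qr}. -/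
theorem derivationConj_laurentEquiv_D {ι : Type*} [Fintype ι] [DecidableEq ι] (l : ι → Kˣ)
    (Q : GL ι ℤ) (u : ι → K) (r : ι → ℤ) :
    derivationConj (laurentEquiv l Q) (D u r) =
      (tpow l (Q.val *ᵥ r) : K) • D (invTranspose K Q *ᵥ u) (Q.val *ᵥ r) := by
  apply witt_ext
  intro n c
  rw [derivationConj_apply, laurentEquiv_symm_single, D_single, laurentEquiv_single,
    Derivation.smul_apply, D_single, invTranspose_mulVec_dotProduct, AddMonoidAlgebra.smul_single,
    Matrix.mulVec_add, GL_mulVec_inv_mulVec, tpow_add]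
  congr 1
  have := (tpow l n).ne_zero
  simp only [Units.val_mul, Units.val_inv_eq_inv_val, smul_eq_mul]
  field_simp

/-- Conjugation is defined on the whole Witt algebra for any Q in GL_N(ℤ); the symplectic condition
is what sends h_r to a multiple of h_{Qr}. -/
theorem map_derivationConj_Ham_le (l : Fin m ⊕ Fin m → Kˣ) (Q : GSp m) :
    ∀ x ∈ Ham K m, derivationConj (laurentEquiv l Q.val) x ∈ Ham K m := by
  obtain ⟨ε, hε⟩ := GSp.exists_sympl Q
  suffices (Ham K m).toSubmodule ≤ (Ham K m).toSubmodule.comap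
      (derivationConj (laurentEquiv l Q.val)).toLinearMap from this
  change Submodule.span K (Set.range (h K m)) ⊔ cartan K m ≤ _
  refine sup_le ?_ ?_
  · rw [Submodule.span_le]
    rintro _ ⟨r, rfl⟩
    change derivationConj (laurentEquiv l Q.val) (D _ _) ∈ Ham K m
    rw [derivationConj_laurentEquiv_D, D_invTranspose hε]
    exact (Ham K m).smul_mem _ ((Ham K m).smul_mem _ (hElt K m _).2)
  · rw [cartan_eq]
    rintro _ ⟨u, rfl⟩
    change derivationConj (laurentEquiv l Q.val) (D u 0) ∈ Ham K m
    rw [derivationConj_laurentEquiv_D, Matrix.mulVec_zero]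
    exact (Ham K m).smul_mem _ (D0Elt _).2

/-- The endomorphism of `H_N` attached to a point of the torus and an element of `GSp_N(ℤ)`. -/
def torusGSpHom (l : Fin m ⊕ Fin m → Kˣ) (Q : GSp m) : Ham K m →ₗ⁅K⁆ Ham K m where
  toFun x := ⟨derivationConj (laurentEquiv l Q.val) x, map_derivationConj_Ham_le l Q x x.2⟩
  map_add' _ _ := Subtype.ext (map_add (derivationConj _) _ _)
  map_smul' _ _ := Subtype.ext (map_smul (derivationConj _) _ _)
  map_lie' {_ _} := Subtype.ext (LieHom.map_lie (derivationConj _) _ _)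

theorem coe_torusGSpHom_hElt (l : Fin m ⊕ Fin m → Kˣ) (Q : GSp m) (r : Fin m ⊕ Fin m → ℤ) :
    (torusGSpHom l Q (hElt K m r) : Witt K (Fin m ⊕ Fin m)) = (tpow l (Q.val.val *ᵥ r) : K) •
      D (invTranspose K Q.val *ᵥ castVec K (J m *ᵥ r)) (Q.val.val *ᵥ r) :=
  derivationConj_laurentEquiv_D l Q.val _ r

theorem torusGSpHom_D0Elt (l : Fin m ⊕ Fin m → Kˣ) (Q : GSp m) (u : Fin m ⊕ Fin m → K) :
    torusGSpHom l Q (D0Elt u : Ham K m) = D0Elt (invTranspose K Q.val *ᵥ u) := by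
  apply Subtype.ext
  refine (derivationConj_laurentEquiv_D l Q.val u 0).trans ?_
  rw [Matrix.mulVec_zero, tpow_zero, Units.val_one, one_smul]
  rfl

theorem torusGSpHom_hElt {l : Fin m ⊕ Fin m → Kˣ} {Q : GSp m} {ε : ℤˣ}
    (hε : ∀ r s, sympl (Q.val.val *ᵥ r) (Q.val.val *ᵥ s) = ε * sympl r s)
    (r : Fin m ⊕ Fin m → ℤ) :
    torusGSpHom l Q (hElt K m r) =
      ((tpow l (Q.val.val *ᵥ r) : K) * ((ε : ℤ) : K)) • hElt K m (Q.val.val *ᵥ r) := by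
  apply Subtype.ext
  rw [coe_torusGSpHom_hElt, D_invTranspose hε, smul_smul]
  rfl

theorem invTranspose_mul {ι : Type*} [Fintype ι] [DecidableEq ι] (P Q : GL ι ℤ) (u : ι → K) :
    invTranspose K (P * Q) *ᵥ u = invTranspose K P *ᵥ (invTranspose K Q *ᵥ u) := by
  apply dotProduct_castVec_ext
  intro r
  rw [invTranspose_mulVec_dotProduct, invTranspose_mulVec_dotProduct,
    invTranspose_mulVec_dotProduct, mul_inv_rev, Units.val_mul, Matrix.mulVec_mulVec]

/-- The semidirect law appears because the inner factor is μ^{Qr} = (P · μ)^{PQr}, which merges with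
λ^{PQr}. -/
theorem torusGSpHom_comp (l l' : Fin m ⊕ Fin m → Kˣ) (P Q : GSp m) :
    (torusGSpHom l P).comp (torusGSpHom l' Q) =
      (torusGSpHom (l * torusAction K m P l') (P * Q) : Ham K m →ₗ⁅K⁆ Ham K m) := by
  obtain ⟨ε, hε⟩ := GSp.exists_sympl P
  obtain ⟨δ, hδ⟩ := GSp.exists_sympl Q
  have hεδ : ∀ r s, sympl ((P * Q).val.val *ᵥ r) ((P * Q).val.val *ᵥ s) =
      ((ε * δ : ℤˣ) : ℤ) * sympl r s := fun r s => by
    rw [Subgroup.coe_mul, Units.val_mul, ← Matrix.mulVec_mulVec, ← Matrix.mulVec_mulVec, hε, hδ,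
      Units.val_mul, mul_assoc]
  suffices ((torusGSpHom l P).comp (torusGSpHom l' Q)).toLinearMap =
      (torusGSpHom (l * torusAction K m P l') (P * Q)).toLinearMap from
    LieHom.ext fun x => LinearMap.congr_fun this x
  apply Ham.linearMap_ext
  · intro r
    change torusGSpHom l P (torusGSpHom l' Q (hElt K m r)) = torusGSpHom _ _ _
    have e : (P⁻¹).val.val *ᵥ ((P.val.val * Q.val.val) *ᵥ r) = Q.val.val *ᵥ r := by
      rw [← Matrix.mulVec_mulVec]
      exact GL_inv_mulVec_mulVec P.val _
    rw [torusGSpHom_hElt hδ, map_smul, torusGSpHom_hElt hε, torusGSpHom_hElt hεδ, smul_smul,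
      Matrix.mulVec_mulVec, Subgroup.coe_mul, Units.val_mul, tpow_mul, tpow_torusAction, e]
    congr 1
    push_cast
    ring
  · intro u
    change torusGSpHom l P (torusGSpHom l' Q (D0Elt u)) = torusGSpHom _ _ _
    rw [torusGSpHom_D0Elt, torusGSpHom_D0Elt, torusGSpHom_D0Elt, Subgroup.coe_mul,
      invTranspose_mul]

theorem invTranspose_one {ι : Type*} [Fintype ι] [DecidableEq ι] (u : ι → K) :
    invTranspose K (1 : GL ι ℤ) *ᵥ u = u := by
  apply dotProduct_castVec_ext
  intro r
  simp [invTranspose_mulVec_dotProduct]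

theorem torusGSpHom_one (x : Ham K m) :
    torusGSpHom (1 : Fin m ⊕ Fin m → Kˣ) (1 : GSp m) x = x := by
  have h1 : ∀ r s, sympl ((1 : GSp m).val.val *ᵥ r) ((1 : GSp m).val.val *ᵥ s) =
      ((1 : ℤˣ) : ℤ) * sympl r s := by simp
  suffices (torusGSpHom (1 : Fin m ⊕ Fin m → Kˣ) (1 : GSp m)).toLinearMap =
      (LinearMap.id : Ham K m →ₗ[K] Ham K m) from LinearMap.congr_fun this x
  apply Ham.linearMap_ext
  · intro r
    change torusGSpHom _ _ _ = hElt K m r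
    rw [torusGSpHom_hElt h1]
    simp [tpow]
  · intro u
    change torusGSpHom _ _ _ = D0Elt u
    rw [torusGSpHom_D0Elt]
    exact congrArg D0Elt (invTranspose_one u)

/-- The automorphism of `H_N` attached to an element of `GSp_N(ℤ) ⋉ (Kˣ)^N`. -/
def torusGSpEquiv (g : (Fin m ⊕ Fin m → Kˣ) ⋊[torusAction K m] GSp m) :
    Ham K m ≃ₗ⁅K⁆ Ham K m :=
  { torusGSpHom g.left g.right with
    invFun := torusGSpHom g⁻¹.left g⁻¹.right
    left_inv := fun x => by
      refine (LieHom.congr_fun (torusGSpHom_comp g⁻¹.left g.left g⁻¹.right g.right) x).trans ?_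
      rw [← SemidirectProduct.mul_left, ← SemidirectProduct.mul_right, inv_mul_cancel]
      exact torusGSpHom_one x
    right_inv := fun x => by
      refine (LieHom.congr_fun (torusGSpHom_comp g.left g⁻¹.left g.right g⁻¹.right) x).trans ?_
      rw [← SemidirectProduct.mul_left, ← SemidirectProduct.mul_right, mul_inv_cancel]
      exact torusGSpHom_one x }

theorem torusGSpEquiv_apply (g : (Fin m ⊕ Fin m → Kˣ) ⋊[torusAction K m] GSp m) (x : Ham K m) :
    torusGSpEquiv g x = torusGSpHom g.left g.right x := rfl

theorem LieEquiv.ext_Ham {σ τ : Ham K m ≃ₗ⁅K⁆ Ham K m} (hh : ∀ r, σ (hElt K m r) = τ (hElt K m r))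
    (hd : ∀ u, σ (D0Elt u) = τ (D0Elt u)) : σ = τ := by
  have : (σ.toLinearEquiv : Ham K m →ₗ[K] Ham K m) = τ.toLinearEquiv := Ham.linearMap_ext hh hd
  apply LieEquiv.ext
  exact fun x => LinearMap.congr_fun this x

/-- The action on 𝔥 determines Q, and the coefficient of h_r in the image of h_{Q⁻¹r} determines λ^r
for r ≠ 0; the basis vectors suffice. -/
theorem torusGSpEquiv_injective [CharZero K] :
    Function.Injective (torusGSpEquiv (K := K) (m := m)) := by
  intro g g' hg
  obtain ⟨ε, hε⟩ := GSp.exists_sympl g.right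
  have hinv : ∀ r, (g.right.val⁻¹).val *ᵥ r = (g'.right.val⁻¹).val *ᵥ r := fun r => by
    apply castVec_injective (K := K)
    apply dotProduct_eq
    intro u
    have h1 := DFunLike.congr_fun hg (D0Elt u)
    rw [torusGSpEquiv_apply, torusGSpEquiv_apply, torusGSpHom_D0Elt, torusGSpHom_D0Elt] at h1
    rw [dotProduct_comm, ← invTranspose_mulVec_dotProduct, D0Elt_injective h1,
      invTranspose_mulVec_dotProduct, dotProduct_comm]
  have hQ : g.right = g'.right := by
    apply Subtype.ext
    apply inv_injective
    apply Units.ext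
    exact Matrix.mulVec_injective (funext hinv)
  have hl (r) (hr : r ≠ 0) : tpow g.left r = tpow g'.left r := by
    have h1 := DFunLike.congr_fun hg (hElt K m ((g.right.val⁻¹).val *ᵥ r))
    rw [torusGSpEquiv_apply, torusGSpEquiv_apply, ← hQ, torusGSpHom_hElt hε, torusGSpHom_hElt hε,
      GL_mulVec_inv_mulVec] at h1
    have h2 := smul_left_injective K (hElt_ne_zero hr) h1
    have hε0 : ((ε : ℤ) : K) ≠ 0 := by simp
    exact Units.ext (mul_right_cancel₀ hε0 h2)
  refine SemidirectProduct.ext (funext fun i => ?_) hQ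
  have h1 (l : Fin m ⊕ Fin m → Kˣ) : tpow l (Pi.single i 1) = l i := by
    have := congr_fun (torusMap_one l) i
    rwa [torusMap, MonoidHom.coe_mk, OneHom.coe_mk, Matrix.one_mulVec] at this
  rw [← h1 g.left, ← h1 g'.left]
  exact hl _ (by simp)

theorem torusGSpEquiv_mul (g g' : (Fin m ⊕ Fin m → Kˣ) ⋊[torusAction K m] GSp m) :
    torusGSpEquiv (g * g') = torusGSpEquiv g * torusGSpEquiv g' :=
  LieEquiv.ext fun x => by
    change torusGSpHom (g * g').left (g * g').right x =
      torusGSpHom g.left g.right (torusGSpHom g'.left g'.right x)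
    rw [SemidirectProduct.mul_left, SemidirectProduct.mul_right, ← torusGSpHom_comp]
    rfl

theorem torusGSpEquiv_surjective [CharZero K] :
    Function.Surjective (torusGSpEquiv (K := K) (m := m)) := fun σ => by
  obtain ⟨Q, l, hh, hd⟩ := exists_GSp_torus_map σ
  refine ⟨⟨l, Q⟩, LieEquiv.ext_Ham (fun r => Subtype.ext ?_) fun u => ?_⟩
  · exact (coe_torusGSpHom_hElt l Q r).trans (hh r).symm
  · exact (torusGSpHom_D0Elt l Q u).trans (hd u).symm

/-- The isomorphism from `GSp_N(ℤ) ⋉ (Kˣ)^N` to the automorphism group of `H_N`. -/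
def torusGSpMulEquiv (K : Type*) [Field K] [CharZero K] (m : ℕ) :
    (Fin m ⊕ Fin m → Kˣ) ⋊[torusAction K m] GSp m ≃* (Ham K m ≃ₗ⁅K⁆ Ham K m) :=
  MulEquiv.ofBijective (MulHom.mk torusGSpEquiv torusGSpEquiv_mul)
    ⟨torusGSpEquiv_injective, torusGSpEquiv_surjective⟩

end

/-! ### Derivations of the derived algebra -/

/-- The derivation `τ d τ⁻¹`, for a Lie algebra automorphism `τ`. -/
def conjLieDerivation {K L : Type*} [Field K] [LieRing L] [LieAlgebra K L] (τ : L ≃ₗ⁅K⁆ L)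
    (d : LieDerivation K L L) : LieDerivation K L L where
  toLinearMap := (τ.toLinearEquiv : L →ₗ[K] L) ∘ₗ d.toLinearMap ∘ₗ τ.symm.toLinearEquiv
  leibniz' a b := by
    change τ (d (τ.symm ⁅a, b⁆)) = ⁅a, τ (d (τ.symm b))⁆ - ⁅b, τ (d (τ.symm a))⁆
    rw [LieEquiv.map_lie, d.apply_lie_eq_sub, map_sub, LieEquiv.map_lie, LieEquiv.map_lie,
      LieEquiv.apply_symm_apply, LieEquiv.apply_symm_apply]

theorem conjLieDerivation_apply {K L : Type*} [Field K] [LieRing L] [LieAlgebra K L]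
    (τ : L ≃ₗ⁅K⁆ L) (d : LieDerivation K L L) (a : L) : conjLieDerivation τ d a = τ (d (τ.symm a)) := rfl

/-- Conjugation of derivations by a Lie algebra automorphism. -/
def lieDerivationConj {K L : Type*} [Field K] [LieRing L] [LieAlgebra K L] (τ : L ≃ₗ⁅K⁆ L) :
    LieDerivation K L L ≃ₗ⁅K⁆ LieDerivation K L L where
  toFun := conjLieDerivation τ
  invFun := conjLieDerivation τ.symm
  map_add' d e := by ext a; simp [conjLieDerivation_apply]
  map_smul' c d := by ext a; simp [conjLieDerivation_apply]
  map_lie' {d e} := by ext a; simp [conjLieDerivation_apply, LieDerivation.lie_apply]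
  left_inv d := by ext a; simp [conjLieDerivation_apply]
  right_inv d := by ext a; simp [conjLieDerivation_apply]

/-- The adjoint action of `H_N` on `H_N'`. -/
def adDerivation (K : Type*) [Field K] (m : ℕ) :
    Ham K m →ₗ⁅K⁆ LieDerivation K (HamDer K m) (HamDer K m) where
  toFun x :=
    { toFun := fun y => ⁅x, y⁆
      map_add' := fun y z => lie_add x y z
      map_smul' := fun a y => lie_smul a x y
      leibniz' := fun y z => Subtype.ext (by
        change ⁅x, ⁅(y : Ham K m), (z : Ham K m)⁆⁆ =
          ⁅(y : Ham K m), ⁅x, (z : Ham K m)⁆⁆ - ⁅(z : Ham K m), ⁅x, (y : Ham K m)⁆⁆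
        rw [leibniz_lie x, ← lie_skew (z : Ham K m) ⁅x, (y : Ham K m)⁆]
        abel) }
  map_add' x y := LieDerivation.ext fun z => add_lie x y z
  map_smul' a x := LieDerivation.ext fun z => smul_lie a x z
  map_lie' {x y} := LieDerivation.ext fun z => lie_lie x y z

section

variable {K : Type*} [Field K] [CharZero K] {m : ℕ}

/-- `h_r` as an element of `H_N'`. -/
def hDer (K : Type*) [Field K] [CharZero K] {m : ℕ} (r : Fin m ⊕ Fin m → ℤ) : HamDer K m :=
  ⟨hElt K m r, mem_HamDer_iff.mpr (dcoeff_hElt r)⟩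

theorem HamDer.linearMap_ext {M : Type*} [AddCommGroup M] [Module K M] {f g : HamDer K m →ₗ[K] M}
    (h : ∀ r, f (hDer K r) = g (hDer K r)) : f = g := by
  ext x
  obtain ⟨S, -, hS⟩ := Ham.exists_eq_sum (x : Ham K m)
  rw [mem_HamDer_iff.mp x.2, D0Elt_zero, zero_add] at hS
  have e : x = ∑ r ∈ S, hcoeff K r (x : Ham K m) • hDer K r := by
    apply Subtype.ext
    rw [AddSubmonoidClass.coe_finsetSum]
    exact hS
  rw [e, map_sum, map_sum]
  exact Finset.sum_congr rfl fun r _ => by rw [map_smul, map_smul, h]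

theorem hDer_lie_hDer (r s : Fin m ⊕ Fin m → ℤ) :
    ⁅hDer K r, hDer K s⁆ = (sympl r s : K) • hDer K (r + s) :=
  Subtype.ext (hElt_lie_hElt r s)

/-- The Leibniz rule on [h_r, h_t], read in degree r + t + s, involves only the degree-s component
of d. -/
theorem hcoeff_derivation_cocycle (d : LieDerivation K (HamDer K m) (HamDer K m))
    (s r t : Fin m ⊕ Fin m → ℤ) :
    (sympl r t : K) * hcoeff K (r + t + s) (d (hDer K (r + t)) : Ham K m) =
      hcoeff K (r + s) (d (hDer K r) : Ham K m) * sympl (r + s) t +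
        hcoeff K (t + s) (d (hDer K t) : Ham K m) * sympl r (t + s) := by
  have h1 := congrArg (fun y : HamDer K m => hcoeff K (r + t + s) (y : Ham K m))
    (d.apply_lie_eq_sub (hDer K r) (hDer K t))
  rw [hDer_lie_hDer, map_smul] at h1
  change hcoeff K _ ((sympl r t : K) • (d (hDer K (r + t)) : Ham K m)) =
    hcoeff K _ (⁅hElt K m r, (d (hDer K t) : Ham K m)⁆ -
      ⁅hElt K m t, (d (hDer K r) : Ham K m)⁆) at h1
  rw [map_smul, map_sub, smul_eq_mul, hcoeff_hElt_lie _ _ (mem_HamDer_iff.mp (d _).2),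
    hcoeff_hElt_lie _ _ (mem_HamDer_iff.mp (d _).2), show r + t + s - r = t + s by abel,
    show r + t + s - t = r + s by abel] at h1
  have e1 : sympl t r = -sympl r t := sympl_skew r t
  have e2 : sympl t s = -sympl s t := sympl_skew s t
  simp only [sympl_add_left, sympl_add_right, sympl_self, e1, e2] at h1 ⊢
  push_cast at h1 ⊢
  linear_combination h1

/-- Every derivation of `H_N'` is the adjoint action of an element of `H_N`. -/
theorem exists_eq_lie_of_derivation (d : LieDerivation K (HamDer K m) (HamDer K m)) :
    ∃ x : Ham K m, ∀ y : HamDer K m, d y = ⁅x, y⁆ := by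
  classical
  let F (s r : Fin m ⊕ Fin m → ℤ) : K := hcoeff K (r + s) (d (hDer K r) : Ham K m)
  have hF0 (s) : F s 0 = 0 := by
    have : hDer K (0 : Fin m ⊕ Fin m → ℤ) = 0 := Subtype.ext hElt_zero
    simp only [F, this, map_zero, ZeroMemClass.coe_zero]
  -- In degree 0 the Leibniz rule is additivity on non-orthogonal pairs, hence everywhere;
  -- `Multiplicative K` turns sums into products so that the lattice lemma applies.
  obtain ⟨u, hu⟩ : ∃ u : Fin m ⊕ Fin m → K, ∀ r, F 0 r = u ⬝ᵥ castVec K r := by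
    refine ⟨_, eq_dotProduct_of_map_add (f := F 0) fun r s => ?_⟩
    refine map_add_of_sympl_ne_zero (G := Multiplicative K) (f := F 0) (hF0 0) (fun r t hrt => ?_)
      r s
    change F 0 (r + t) = F 0 r + F 0 t
    have h1 := hcoeff_derivation_cocycle d 0 r t
    have hrt' : (sympl r t : K) ≠ 0 := by simpa using hrt
    rw [add_zero t, add_zero r] at h1
    apply mul_left_cancel₀ hrt'
    simp only [F, add_zero] at h1 ⊢
    linear_combination h1
  have hc (s) : ∃ c : K, s ≠ 0 → ∀ r, F s r = c * sympl s r := by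
    by_cases hs : s = 0
    · exact ⟨0, fun h => absurd hs h⟩
    · obtain ⟨c, hc⟩ := eq_smul_sympl_of_cocycle (f := F s) hs
        (by simp only [F, neg_add_cancel, hcoeff_zero]) (hcoeff_derivation_cocycle d s)
      exact ⟨c, fun _ => hc⟩
  choose c hc using hc
  -- Only finitely many degrees occur: each d h_{e_i} has finite support, and every s ≠ 0 pairs
  -- nontrivially with some e_i, so c s ≠ 0 is visible there.
  have hfin (i : Fin m ⊕ Fin m) : ∃ S : Finset (Fin m ⊕ Fin m → ℤ),
      ∀ s, F s (Pi.single i 1) ≠ 0 → s ∈ S := by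
    obtain ⟨S, hS, -⟩ := Ham.exists_eq_sum (d (hDer K (Pi.single i 1)) : Ham K m)
    refine ⟨S.image fun t => t - Pi.single i 1, fun s hs => ?_⟩
    exact Finset.mem_image.mpr ⟨_, (hS _).mpr hs, add_sub_cancel_left _ _⟩
  choose S hS using hfin
  let T := Finset.univ.biUnion S
  have hT (s) (hs : s ≠ 0) (hsT : s ∉ T) : c s = 0 := by
    obtain ⟨i, hi⟩ := exists_sympl_single_ne_zero hs
    by_contra h0
    refine hsT (Finset.mem_biUnion.mpr ⟨i, Finset.mem_univ i, hS i s ?_⟩)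
    rw [hc s hs]
    exact mul_ne_zero h0 (by simpa using hi)
  let x : Ham K m := D0Elt u + ∑ s ∈ T, c s • hElt K m s
  refine ⟨x, fun y => ?_⟩
  suffices h : d.toLinearMap =
      (LieModule.toEnd K (Ham K m) (HamDer K m) x : HamDer K m →ₗ[K] _) from
    LinearMap.congr_fun h y
  apply HamDer.linearMap_ext
  intro r
  change d (hDer K r) = ⁅x, hDer K r⁆
  apply Subtype.ext
  change (d (hDer K r) : Ham K m) = ⁅x, hElt K m r⁆
  apply Ham.ext_coeff
  · rw [dcoeff_lie, mem_HamDer_iff.mp (d _).2]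
  intro t
  by_cases ht : t = 0
  · simp [ht]
  have hFt : hcoeff K t (d (hDer K r) : Ham K m) = F (t - r) r := by
    simp only [F, add_sub_cancel]
  simp only [hFt, x, add_lie, sum_lie, smul_lie, D0Elt_lie_hElt, hElt_lie_hElt, map_add, map_sum,
    map_smul, hcoeff_hElt ht, smul_eq_mul]
  by_cases htr : t = r
  · subst htr
    rw [sub_self, hu, if_pos rfl, mul_one, Finset.sum_eq_zero, add_zero]
    intro s _
    by_cases hs : s = 0 <;> simp [hs]
  · rw [if_neg (Ne.symm htr), mul_zero, zero_add, hc _ (sub_ne_zero.mpr htr),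
      Finset.sum_eq_single (t - r)]
    · simp
    · intro s _ hs
      rw [if_neg fun h => hs (eq_sub_of_add_eq h), mul_zero, mul_zero]
    · intro h
      rw [hT _ (sub_ne_zero.mpr htr) h, zero_mul]

/-- An element centralising H_N' is zero: for (Js, e_i) ≠ 0, the coefficient of h_{s+e_i} in its
bracket with h_{e_i} detects its h_s-component, and the remaining D(u,0) acts on each h_r by (u, r).
-/
theorem adDerivation_injective : Function.Injective (adDerivation K m) := by
  intro x y hxy
  rw [← sub_eq_zero]
  have hz (r) : ⁅x - y, hElt K m r⁆ = 0 := by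
    have := congrArg (Subtype.val) (DFunLike.congr_fun hxy (hDer K r))
    change ⁅x, hElt K m r⁆ = ⁅y, hElt K m r⁆ at this
    rw [sub_lie, this, sub_self]
  obtain ⟨S, hS0, hS⟩ := Ham.exists_eq_sum (x - y)
  have hcoeff0 (s) : hcoeff K s (x - y) = 0 := by
    by_cases hs : s = 0
    · simp [hs]
    obtain ⟨i, hi⟩ := exists_sympl_single_ne_zero hs
    set r : Fin m ⊕ Fin m → ℤ := Pi.single i 1
    have hr : r ≠ 0 := by intro h; rw [h] at hi; simp at hi
    have hsr : s + r ≠ 0 := fun h => hi (by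
      rw [eq_neg_of_add_eq_zero_right h, sympl_neg_right, sympl_self, neg_zero])
    have h1 := hcoeff_lie (x - y) (dcoeff_hElt r) hS (s + r)
    rw [hz, map_zero, hcoeff_hElt hsr, if_neg (by simpa using hs), mul_zero, zero_add,
      Finset.sum_eq_single s] at h1
    · rw [add_sub_cancel_left, hcoeff_hElt hr, if_pos rfl, mul_one, sympl_add_right, sympl_self,
        zero_add] at h1
      exact (mul_eq_zero.mp h1.symm).resolve_right (by simpa using hi)
    · intro s' _ hs'
      by_cases h0 : s + r - s' = 0
      · simp [h0]
      · rw [hcoeff_hElt h0, if_neg fun h => hs' ?_, mul_zero, mul_zero]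
        rw [eq_sub_iff_add_eq, add_comm s r] at h
        exact add_left_cancel h
    · intro hsS
      rw [not_not.mp fun h => hsS ((hS0 s).mpr h), zero_mul]
  have hd : dcoeff K m (x - y) = 0 := by
    apply dotProduct_castVec_ext
    intro r
    rw [zero_dotProduct]
    by_cases hr : r = 0
    · simp [hr]
    have h1 := hz r
    rw [Ham.eq_D0Elt hcoeff0, D0Elt_lie_hElt] at h1
    exact (smul_eq_zero.mp h1).resolve_right (hElt_ne_zero hr)
  exact Ham.ext_coeff (by rw [hd, map_zero]) fun r => by rw [hcoeff0, map_zero]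

/-- The derivations of `H_N'` form the Lie algebra `H_N`. -/
def adDerivationEquiv (K : Type*) [Field K] [CharZero K] (m : ℕ) :
    Ham K m ≃ₗ⁅K⁆ LieDerivation K (HamDer K m) (HamDer K m) :=
  LieEquiv.ofBijective (adDerivation K m) ⟨adDerivation_injective, fun d => by
    obtain ⟨x, hx⟩ := exists_eq_lie_of_derivation d
    exact ⟨x, LieDerivation.ext fun y => (hx y).symm⟩⟩

/-! ### Extension and restriction of automorphisms -/

/-- The extension of an automorphism of `H_N'` to `H_N`. -/
def extendAut (τ : HamDer K m ≃ₗ⁅K⁆ HamDer K m) : Ham K m ≃ₗ⁅K⁆ Ham K m :=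
  ((adDerivationEquiv K m).trans (lieDerivationConj τ)).trans (adDerivationEquiv K m).symm

/-- For x in H_N', conjugating ad x by τ gives ad (τ x). -/
theorem extendAut_coe (τ : HamDer K m ≃ₗ⁅K⁆ HamDer K m) (x : HamDer K m) :
    extendAut τ (x : Ham K m) = (τ x : Ham K m) := by
  change (adDerivationEquiv K m).symm (lieDerivationConj τ (adDerivationEquiv K m x)) = _
  rw [← (adDerivationEquiv K m).symm_apply_apply (τ x : Ham K m)]
  congr 1
  ext1 y
  change τ ⁅x, τ.symm y⁆ = ⁅τ x, y⁆
  rw [LieEquiv.map_lie, LieEquiv.apply_symm_apply]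

theorem map_mem_HamDer (σ : Ham K m ≃ₗ⁅K⁆ Ham K m) {x : Ham K m} (hx : x ∈ HamDer K m) :
    σ x ∈ HamDer K m := by
  have : dcoeff K m ∘ₗ (σ.toLinearEquiv : Ham K m →ₗ[K] Ham K m) ∘ₗ
      (HamDer K m).toSubmodule.subtype = 0 := by
    apply HamDer.linearMap_ext
    intro r
    change dcoeff K m (σ (hElt K m r)) = 0
    obtain ⟨t, -, c, hc⟩ := exists_map_hElt σ r
    rw [hc, map_smul, dcoeff_hElt, smul_zero]
  exact mem_HamDer_iff.mpr (LinearMap.congr_fun this ⟨x, hx⟩)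

/-- The restriction of automorphisms of `H_N` to `H_N'`. -/
def restrictAut (σ : Ham K m ≃ₗ⁅K⁆ Ham K m) : HamDer K m ≃ₗ⁅K⁆ HamDer K m where
  toFun x := ⟨σ x, map_mem_HamDer σ x.2⟩
  invFun x := ⟨σ.symm x, map_mem_HamDer σ.symm x.2⟩
  map_add' _ _ := Subtype.ext (map_add σ _ _)
  map_smul' _ _ := Subtype.ext (map_smul σ _ _)
  map_lie' {_ _} := Subtype.ext (LieEquiv.map_lie σ _ _)
  left_inv x := Subtype.ext (σ.symm_apply_apply x)
  right_inv x := Subtype.ext (σ.apply_symm_apply x)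

theorem coe_restrictAut (σ : Ham K m ≃ₗ⁅K⁆ Ham K m) (x : HamDer K m) :
    (restrictAut σ x : Ham K m) = σ x := rfl

/-- For z in the ideal H_N', [x, z] lies in H_N', so σ[x, z] = τ[x, z]. Thus σ x and τ x have the
same brackets with σ z = τ z, which runs over H_N', and the centraliser is zero. -/
theorem restrictAut_injective : Function.Injective (restrictAut (K := K) (m := m)) := by
  intro σ τ h
  have hres (x : Ham K m) (hx : x ∈ HamDer K m) : σ x = τ x :=
    congrArg Subtype.val (DFunLike.congr_fun h (⟨x, hx⟩ : HamDer K m))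
  apply LieEquiv.ext
  intro x
  apply adDerivation_injective
  ext1 y
  apply Subtype.ext
  change ⁅σ x, (y : Ham K m)⁆ = ⁅τ x, (y : Ham K m)⁆
  have hy : σ.symm (y : Ham K m) ∈ HamDer K m := map_mem_HamDer σ.symm y.2
  have e1 : σ (σ.symm (y : Ham K m)) = y := σ.apply_symm_apply _
  have e2 : τ (σ.symm (y : Ham K m)) = y := by rw [← hres _ hy, e1]
  conv_lhs => rw [← e1]
  conv_rhs => rw [← e2]
  rw [← LieEquiv.map_lie, ← LieEquiv.map_lie]
  exact hres _ (lie_mem_right K (Ham K m) (HamDer K m) x _ hy)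

/-- Restriction is an isomorphism from the automorphism group of `H_N` to that of `H_N'`. -/
def restrictMulEquiv (K : Type*) [Field K] [CharZero K] (m : ℕ) :
    (Ham K m ≃ₗ⁅K⁆ Ham K m) ≃* (HamDer K m ≃ₗ⁅K⁆ HamDer K m) :=
  MulEquiv.ofBijective (MulHom.mk restrictAut fun _ _ => rfl)
    ⟨restrictAut_injective, fun τ => ⟨extendAut τ,
      LieEquiv.ext fun x => Subtype.ext (extendAut_coe τ x)⟩⟩

theorem image_HamDer (σ : Ham K m ≃ₗ⁅K⁆ Ham K m) :
    σ '' (HamDer K m : Set (Ham K m)) = (HamDer K m : Set (Ham K m)) := by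
  apply Set.Subset.antisymm
  · rintro _ ⟨x, hx, rfl⟩
    exact map_mem_HamDer σ hx
  · exact fun x hx => ⟨σ.symm x, map_mem_HamDer σ.symm hx, σ.apply_symm_apply x⟩

theorem map_mem_cartanHam (σ : Ham K m ≃ₗ⁅K⁆ Ham K m) {x : Ham K m} (hx : x ∈ cartanHam K m) :
    σ x ∈ cartanHam K m := by
  obtain ⟨u, rfl⟩ := mem_cartanHam_iff.mp hx
  exact mem_cartanHam_iff.mpr ⟨_, exists_map_D0Elt σ u⟩

theorem image_cartanHam (σ : Ham K m ≃ₗ⁅K⁆ Ham K m) :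
    σ '' (cartanHam K m : Set (Ham K m)) = (cartanHam K m : Set (Ham K m)) := by
  apply Set.Subset.antisymm
  · rintro _ ⟨x, hx, rfl⟩
    exact map_mem_cartanHam σ hx
  · exact fun x hx => ⟨σ.symm x, map_mem_cartanHam σ.symm hx, σ.apply_symm_apply x⟩

end

end

end HamTorus

open HamTorus in
theorem theorem3p6 {K : Type*} [Field K] [IsAlgClosed K] [CharZero K] (m : ℕ) (hm : 1 ≤ m) :
    (∃ (Φ : (Ham K m ≃ₗ⁅K⁆ Ham K m) ≃* (Fin m ⊕ Fin m → Kˣ) ⋊[torusAction K m] GSp m)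
      (Ψ : (HamDer K m ≃ₗ⁅K⁆ HamDer K m) ≃* (Fin m ⊕ Fin m → Kˣ) ⋊[torusAction K m] GSp m),
      (∀ (σ : Ham K m ≃ₗ⁅K⁆ Ham K m) (x : HamDer K m),
        ((Ψ.symm (Φ σ) x : HamDer K m) : Ham K m) = σ (x : Ham K m)) ∧
      (∀ (σ : Ham K m ≃ₗ⁅K⁆ Ham K m) (r : Fin m ⊕ Fin m → ℤ),
        (σ (hElt K m r) : Witt K (Fin m ⊕ Fin m)) =
          (tpow (Φ σ).left ((Φ σ).right.val.val *ᵥ r) : K) •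
            D (invTranspose K (Φ σ).right.val *ᵥ castVec K (J m *ᵥ r))
              ((Φ σ).right.val.val *ᵥ r)) ∧
      (∀ (σ : Ham K m ≃ₗ⁅K⁆ Ham K m) (u : Fin m ⊕ Fin m → K),
        σ (D0Elt u) = D0Elt (invTranspose K (Φ σ).right.val *ᵥ u))) ∧
    (∀ σ : Ham K m ≃ₗ⁅K⁆ Ham K m,
      σ '' (HamDer K m : Set (Ham K m)) = (HamDer K m : Set (Ham K m)) ∧
      σ '' (cartanHam K m : Set (Ham K m)) = (cartanHam K m : Set (Ham K m))) := by
  -- Ψ is the inverse of the parametrisation followed by restriction, so Ψ⁻¹ ∘ Φ is restriction by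
  -- construction.
  refine ⟨⟨(torusGSpMulEquiv K m).symm,
    ((torusGSpMulEquiv K m).trans (restrictMulEquiv K m)).symm, fun σ x => ?_, fun σ r => ?_,
    fun σ u => ?_⟩, fun σ => ⟨image_HamDer σ, image_cartanHam σ⟩⟩
  · rw [MulEquiv.symm_symm, MulEquiv.trans_apply, MulEquiv.apply_symm_apply]
    exact coe_restrictAut σ x
  · obtain ⟨g, rfl⟩ := (torusGSpMulEquiv K m).surjective σ
    rw [MulEquiv.symm_apply_apply]
    exact coe_torusGSpHom_hElt g.left g.right r
  · obtain ⟨g, rfl⟩ := (torusGSpMulEquiv K m).surjective σ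
    rw [MulEquiv.symm_apply_apply]
    exact torusGSpHom_D0Elt g.left g.right u
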